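/- Let $p>0$ and $\Lambda\in\mathbb{R}$, and consider the problem $$\Delta^2u=(1-|x|^p)e^{4u}\ \text{ in }\mathbb{R}^4,\qquad \Lambda=\int_{\mathbb{R}^4}(1-|x|^p)e^{4u(x)}\,dx. \tag{P}$$ A function $u:\mathbb{R}^4\to\mathbb{R}$ is called a normal solution of (P) if $(1-|x|^p)e^{4u}\in L^1(\mathbb{R}^4)$, $\Lambda=\int_{\mathbb{R}^4}(1-|x|^p)e^{4u}\,dx$, and there is a constant $c\in\mathbb{R}$ such that $$u(x)=\frac{1}{8\pi^2}\int_{\mathbb{R}^4}\log\left(\frac{|y|}{|x-y|}\right)(1-|y|^p)e^{4u(y)}\,dy+c$$ for almost every $x\in\mathbb{R}^4$, the integral being absolutely convergent. Set $\Lambda_{\mathrm{sph}}:=16\pi^2$ and $\Lambda_{*,p}:=(4+p)2\pi^2$. Then: 1. for every $\Lambda\in(-\infty,\Lambda_{*,p})\cup[\Lambda_{\mathrm{sph}},\infty)$, problem (P) has no normal solution; 2. if $p\ge 4$, problem (P) has no normal solution for any $\Lambda\in\mathbb{R}$. -/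

import Mathlib

open MeasureTheory

noncomputable section

/-- Euclidean four-space. -/
abbrev R4 : Type := EuclideanSpace ℝ (Fin 4)

/-- `u` is a normal solution of `Δ² u = K e^{4u}` on `ℝ⁴`: the right-hand side `K e^{4u}` is
Lebesgue integrable, and for some constant `c` the function `u` solves the integral equation
`u(x) = (1 / 8π²) ∫ log (|y| / |x - y|) K(y) e^{4u(y)} dy + c`, the integral being absolutely
convergent. The equation is only required for almost every `x`, and no regularity of `u` is
assumed. -/
def IsNormalSolution (K u : R4 → ℝ) : Prop :=
  Integrable (fun y : R4 => K y * Real.exp (4 * u y)) volume ∧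
  ∃ c : ℝ, ∀ᵐ x : R4 ∂volume,
    Integrable
      (fun y : R4 => Real.log (‖y‖ / ‖x - y‖) * (K y * Real.exp (4 * u y))) volume ∧
    u x = 1 / (8 * Real.pi ^ 2) *
      (∫ y : R4, Real.log (‖y‖ / ‖x - y‖) * (K y * Real.exp (4 * u y))) + c

/-- The curvature function `K(x) = 1 - |x|^p`. -/
def curvK (p : ℝ) (x : R4) : ℝ := 1 - ‖x‖ ^ p

/-- `u` is a normal solution of the problem
`Δ² u = (1 - |x|^p) e^{4u}` in `ℝ⁴`, `Λ = ∫ (1 - |x|^p) e^{4u} dx`. -/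
def IsNormalSolutionWithCurvature (p Λ : ℝ) (u : R4 → ℝ) : Prop :=
  IsNormalSolution (curvK p) u ∧
    Λ = ∫ x : R4, curvK p x * Real.exp (4 * u x)

/-- The total `Q`-curvature of the round sphere `S⁴`. -/
def LambdaSph : ℝ := 16 * Real.pi ^ 2

/-- The threshold `Λ_{*,p} = (4 + p) 2π²`. -/
def LambdaStar (p : ℝ) : ℝ := (4 + p) * (2 * Real.pi ^ 2)

end

open Filter Topology Real

/-! ### The logarithmic kernel -/

/-! Every normal solution satisfies `LambdaStar p ≤ Λ` and `Λ < LambdaSph`. Both claims follow,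
since for `p ≥ 4` these two bounds are incompatible.

Upper bound: the Pohozaev identity (`pohozaev`) reads `4Λ - p ∫ |x|^p e^{4u} = Λ² / (4π²)`. The
subtracted integral is positive, so `Λ (16π² - Λ) > 0`.

Lower bound: in the mean, `u` behaves at infinity like `-(Λ / 8π²) log |x|`, while `|x|^p e^{4u}` is
integrable. In dimension four this is possible only if `Λ / (2π²) ≥ 4 + p`. Averaging over balls of
radius `R` at distance of order `R` from the origin (`tendsto_integral_meanLogKernel`) and using `s
+ 1 ≤ exp s` makes this rigorous without pointwise asymptotics (`le_integral_of_eq_curvK_mul_exp`).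

As no regularity of `u` is assumed, the Pohozaev identity needs preparation. A Brezis–Merle estimate
(`locallyIntegrable_exp_logPot`) makes `e^{8u}` locally integrable, so the density `f = K e^{4u}` is
locally square integrable. Since `|z|⁻²` is locally integrable on `ℝ⁴`, the Riesz potential of `|f|`
with kernel `|x - y|⁻¹` is then locally bounded (`hasLocallyBoundedRiesz_of_sq`), which controls
both `u` and `x · ∇u`. The identity is derived by dilating a cut-off integral with the kernel
regularised at scale `ε`. Then `ε → 0`, the double integral is symmetrised in `x` and `y`, and the
cutoff radius tends to infinity. -/

/-- The truncated singular kernel `|z|⁻²` on the unit ball, extended by zero. -/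
noncomputable def truncKernel (z : R4) : ℝ :=
  (Metric.ball (0 : R4) 1).indicator (fun z => (‖z‖ ^ 2)⁻¹) z

lemma truncKernel_nonneg (z : R4) : 0 ≤ truncKernel z :=
  Set.indicator_nonneg (fun _ _ => by positivity) z

lemma truncKernel_of_lt {z : R4} (hz : ‖z‖ < 1) : truncKernel z = (‖z‖ ^ 2)⁻¹ :=
  Set.indicator_of_mem (by simpa using hz) _

/-- In polar coordinates the weight `t³` turns `t⁻²` into `t`. -/
lemma integrable_truncKernel : Integrable truncKernel (volume : Measure R4) := by
  have h := integrable_fun_norm_addHaar (volume : Measure R4)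
    (f := (Set.Iio (1 : ℝ)).indicator fun t => (t ^ 2)⁻¹)
  have e : (fun z : R4 => (Set.Iio (1 : ℝ)).indicator (fun t => (t ^ 2)⁻¹) ‖z‖) = truncKernel := by
    funext z
    simp [truncKernel, Set.indicator]
  rw [← e, h]
  have hb : IntegrableOn ((Set.Ioo (0 : ℝ) 1).indicator fun t => t) (Set.Ioi 0) := by
    rw [integrableOn_indicator_iff measurableSet_Ioo]
    exact ((continuous_id.integrableOn_Icc (a := (0 : ℝ)) (b := 1)).mono_set
      (Set.inter_subset_left.trans Set.Ioo_subset_Icc_self))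
  refine hb.congr_fun (fun t ht => ?_) measurableSet_Ioi
  have ht : 0 < t := ht
  by_cases h1 : t < 1
  · have e1 : t ^ 3 = t * t ^ 2 := by ring
    simp [h1, ht, e1, ht.ne']
  · simp [h1]

/-- The negative part of the logarithm. -/
noncomputable def negLog (t : ℝ) : ℝ := log⁺ t⁻¹

lemma negLog_nonneg (t : ℝ) : 0 ≤ negLog t := posLog_nonneg

lemma measurable_negLog : Measurable negLog :=
  continuous_posLog.measurable.comp measurable_inv

lemma negLog_of_one_le {t : ℝ} (ht : 1 ≤ t) : negLog t = 0 := by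
  rw [negLog, posLog_eq_zero_iff, abs_inv]
  exact inv_le_one_of_one_le₀ (ht.trans (le_abs_self _))

lemma neg_log_le_negLog (t : ℝ) : -log t ≤ negLog t := by
  rw [← log_inv]
  exact le_max_right _ _

lemma negLog_anti {s t : ℝ} (hs : 0 < s) (h : s ≤ t) : negLog t ≤ negLog s :=
  posLog_le_posLog (inv_nonneg.2 (hs.le.trans h)) (inv_anti₀ hs h)

/-- For `0 < |z| < 1` the left side is `|z|⁻¹ ≤ |z|⁻²`. This turns the exponential produced by
Jensen's inequality into an integrable kernel. -/
lemma exp_negLog_le (z : R4) : exp (negLog ‖z‖) ≤ 1 + truncKernel z := by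
  rcases le_or_gt 1 ‖z‖ with h | h
  · simpa [negLog_of_one_le h] using truncKernel_nonneg z
  rcases (norm_nonneg z).eq_or_lt with h0 | h0
  · simpa [negLog, ← h0] using truncKernel_nonneg z
  · have h1 : 1 ≤ ‖z‖⁻¹ := (one_le_inv₀ h0).2 h.le
    rw [negLog, posLog_eq_log (h1.trans (le_abs_self _)), exp_log (by positivity),
      truncKernel_of_lt h, ← inv_pow]
    nlinarith

lemma negLog_le_truncKernel (z : R4) : negLog ‖z‖ ≤ truncKernel z := by
  have := add_one_le_exp (negLog ‖z‖)
  linarith [exp_negLog_le z]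

lemma negLog_le_inv {t : ℝ} (ht : 0 ≤ t) : negLog t ≤ t⁻¹ := by
  rcases ht.eq_or_lt with h0 | h0
  · simp [negLog, ← h0]
  · refine max_le (by positivity) ?_
    have := log_le_sub_one_of_pos (inv_pos.2 h0)
    linarith

/-- The logarithmic kernel `log |y| - log √(|x - y|² + ε²)`, regularised at scale `ε`. -/
noncomputable def logKernel (ε : ℝ) (x y : R4) : ℝ :=
  log ‖y‖ - log (‖x - y‖ ^ 2 + ε ^ 2) / 2

lemma logKernel_zero {x y : R4} (hy : y ≠ 0) (hxy : y ≠ x) :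
    logKernel 0 x y = log (‖y‖ / ‖x - y‖) := by
  rw [logKernel, log_div (norm_ne_zero_iff.2 hy) (norm_ne_zero_iff.2 (sub_ne_zero.2 hxy.symm))]
  simp

lemma measurable_logKernel (ε : ℝ) : Measurable fun q : R4 × R4 => logKernel ε q.1 q.2 := by
  unfold logKernel
  fun_prop

/-- Where the points are not close to the singularities, `|y|` and `|x - y|` are comparable up to
the factor `2 + |x|`; elsewhere a negative logarithm absorbs the singularity. Uniformity in `|ε| ≤
1` is what later permits `ε → 0`. -/
lemma abs_logKernel_le {ε : ℝ} (hε : |ε| ≤ 1) {x y : R4} (hy : y ≠ 0) (hxy : y ≠ x) :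
    |logKernel ε x y| ≤ log (2 + ‖x‖) + negLog ‖y‖ + negLog ‖x - y‖ := by
  have hy0 : 0 < ‖y‖ := norm_pos_iff.2 hy
  have hz0 : 0 < ‖x - y‖ := norm_pos_iff.2 (sub_ne_zero.2 hxy.symm)
  have hx : 0 < 2 + ‖x‖ := by positivity
  have hx0 := norm_nonneg x
  have hε2 : ε ^ 2 ≤ 1 := (sq_le_one_iff_abs_le_one ε).2 hε
  have t1 : ‖x - y‖ ≤ ‖x‖ + ‖y‖ := norm_sub_le x y
  have t2 : ‖y‖ ≤ ‖x‖ + ‖x - y‖ := by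
    have := norm_sub_le x (x - y)
    simpa using this
  have hl : log (‖x - y‖ ^ 2) = 2 * log ‖x - y‖ := by simp
  have low : 2 * log ‖x - y‖ ≤ log (‖x - y‖ ^ 2 + ε ^ 2) := by
    rw [← hl]
    exact log_le_log (by positivity) (by nlinarith [sq_nonneg ε])
  have n1 := neg_log_le_negLog ‖x - y‖
  have n2 := neg_log_le_negLog ‖y‖
  have p1 := negLog_nonneg ‖x - y‖
  have p2 := negLog_nonneg ‖y‖
  have up : ∀ b : ℝ, 0 < b → ‖x - y‖ ^ 2 + ε ^ 2 ≤ b ^ 2 →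
      log (‖x - y‖ ^ 2 + ε ^ 2) ≤ 2 * log b := by
    intro b hb h
    have : log (b ^ 2) = 2 * log b := by simp
    rw [← this]
    exact log_le_log (by positivity) h
  have two : 0 ≤ log (2 + ‖x‖) := log_nonneg (by linarith)
  rw [abs_le, logKernel]
  constructor
  · rcases le_or_gt 1 ‖y‖ with h | h
    · have := up ((2 + ‖x‖) * ‖y‖) (by positivity) (by
        have : ‖x - y‖ + 1 ≤ (2 + ‖x‖) * ‖y‖ := by nlinarith
        nlinarith)
      rw [log_mul hx.ne' hy0.ne'] at this
      linarith
    · have := up (2 + ‖x‖) hx (by nlinarith)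
      linarith
  · rcases le_or_gt 1 ‖x - y‖ with h | h
    · have : log ‖y‖ ≤ log ((2 + ‖x‖) * ‖x - y‖) := log_le_log hy0 (by nlinarith)
      rw [log_mul hx.ne' hz0.ne'] at this
      linarith
    · have : log ‖y‖ ≤ log (2 + ‖x‖) := log_le_log hy0 (by nlinarith)
      linarith

/-- Tangent line form of Jensen's inequality for the exponential. -/
lemma exp_integral_div_le {α : Type*} [MeasurableSpace α] {μ : Measure α} {g w : α → ℝ} {b : ℝ}
    (hg : ∀ x, 0 ≤ g x) (hw : ∀ x, 0 ≤ w x) (hwi : Integrable w μ)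
    (hgw : Integrable (fun x => g x * w x) μ) (hew : Integrable (fun x => exp (g x) * w x) μ)
    (hb : ∫ x, w x ∂μ ≤ b) :
    exp ((∫ x, g x * w x ∂μ) / b) ≤ 1 + (∫ x, w x ∂μ)⁻¹ * ∫ x, exp (g x) * w x ∂μ := by
  set a := ∫ x, w x ∂μ with ha
  have ha0 : 0 ≤ a := integral_nonneg hw
  rcases ha0.eq_or_lt with h0 | h0
  · have hz : w =ᵐ[μ] 0 := (integral_eq_zero_iff_of_nonneg hw hwi).1 h0.symm
    have : ∫ x, g x * w x ∂μ = 0 := by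
      rw [integral_eq_zero_of_ae]
      filter_upwards [hz] with x hx
      simp [hx]
    simp [this, ← h0]
  · set I := ∫ x, g x * w x ∂μ with hI
    have hI0 : 0 ≤ I := integral_nonneg fun x => mul_nonneg (hg x) (hw x)
    have h1 : exp (I / b) ≤ exp (I / a) :=
      exp_le_exp.2 (div_le_div_of_nonneg_left hI0 h0 hb)
    have h2 : a * exp (I / a) ≤ ∫ x, exp (g x) * w x ∂μ := by
      -- This integrates the tangent line of `exp` at the mean `I / a`; the term `g - I / a` has
      -- zero `w`-mean.
      have e : a * exp (I / a) = ∫ x, (exp (I / a) * ((g x * w x) + (1 - I / a) * w x)) ∂μ := by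
        rw [integral_const_mul, integral_add hgw (hwi.const_mul _), integral_const_mul, ← ha, ← hI]
        field_simp
        ring
      rw [e]
      refine integral_mono ((hgw.add (hwi.const_mul _)).const_mul _) hew fun x => ?_
      have h3 := add_one_le_exp (g x - I / a)
      rw [exp_sub, le_div_iff₀ (exp_pos _)] at h3
      have := mul_le_mul_of_nonneg_right h3 (hw x)
      dsimp only
      linarith
    have h3 : exp (I / a) ≤ a⁻¹ * ∫ x, exp (g x) * w x ∂μ := by
      rw [inv_mul_eq_div, le_div_iff₀ h0]
      linarith
    linarith

/-! ### Logarithmic potentials and their local regularity -/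

/-- The logarithmic potential of the density `f`, with kernel regularised at scale `ε`. -/
noncomputable def logPot (f : R4 → ℝ) (c ε : ℝ) (x : R4) : ℝ :=
  1 / (8 * π ^ 2) * (∫ y, logKernel ε x y * f y) + c

lemma ae_ne_pair (x : R4) : ∀ᵐ y : R4 ∂volume, y ≠ 0 ∧ y ≠ x :=
  (Measure.ae_ne volume 0).and (Measure.ae_ne volume x)

lemma aestronglyMeasurable_logPot {f : R4 → ℝ} (hf : Integrable f) (c ε : ℝ) :
    AEStronglyMeasurable (logPot f c ε) volume := by
  have h : AEStronglyMeasurable (fun q : R4 × R4 => logKernel ε q.1 q.2 * f q.2)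
      (volume.prod volume) :=
    (measurable_logKernel ε).aestronglyMeasurable.mul hf.aestronglyMeasurable.comp_snd
  exact (h.integral_prod_right'.const_mul _).add_const _

/-- For a single admissible `x` with `|x| > 2`, the points `|y| < 1` have `|x - y| > 1`, so `log |x
- y| ≥ 0` and `-log |y|` is dominated by the absolute value of the kernel. Such an `x` exists
because a set of full measure is dense. -/
lemma integrable_negLog_mul {f : R4 → ℝ} (hf : Integrable f)
    (h : ∀ᵐ x : R4 ∂volume, Integrable (fun y : R4 => log (‖y‖ / ‖x - y‖) * f y)) :
    Integrable (fun y => negLog ‖y‖ * f y) := by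
  obtain ⟨x, hx, hxi⟩ : ∃ x : R4, 2 < ‖x‖ ∧
      Integrable (fun y : R4 => log (‖y‖ / ‖x - y‖) * f y) := by
    have ho : IsOpen {x : R4 | 2 < ‖x‖} := isOpen_lt continuous_const continuous_norm
    obtain ⟨v, hv⟩ := NormedSpace.exists_lt_norm ℝ R4 2
    exact (Measure.dense_of_ae h).inter_open_nonempty _ ho ⟨v, hv⟩
  refine hxi.norm.mono' ((measurable_negLog.comp measurable_norm).aestronglyMeasurable.mul
    hf.aestronglyMeasurable) (ae_of_all _ fun y => ?_)
  rw [norm_mul, norm_mul]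
  refine mul_le_mul_of_nonneg_right ?_ (norm_nonneg _)
  rw [norm_of_nonneg (negLog_nonneg _), norm_eq_abs]
  rcases le_or_gt 1 ‖y‖ with h1 | h1
  · rw [negLog_of_one_le h1]
    positivity
  rcases eq_or_ne y 0 with rfl | hy
  · simp [negLog]
  have hy0 : 0 < ‖y‖ := norm_pos_iff.2 hy
  have t2 : ‖x‖ - ‖y‖ ≤ ‖x - y‖ := norm_sub_norm_le x y
  have t3 : 0 ≤ log ‖x - y‖ := log_nonneg (by linarith)
  rw [negLog, posLog_eq_log (((one_le_inv₀ hy0).2 h1.le).trans (le_abs_self _)), log_inv,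
    log_div hy0.ne' (by linarith)]
  linarith [neg_abs_le (log ‖y‖ - log ‖x - y‖)]

/-- A convolution of two `L¹` functions: by Fubini, the inner integral is finite for almost every
`x` and integrable in `x`. -/
lemma integrable_truncKernel_conv {f : R4 → ℝ} (hf : Integrable f) :
    Integrable (fun q : R4 × R4 => truncKernel (q.1 - q.2) * |f q.2|) (volume.prod volume) := by
  have := hf.abs.convolution_integrand (ContinuousLinearMap.mul ℝ ℝ) integrable_truncKernel
  refine this.congr (ae_of_all _ fun q => ?_)
  simp [mul_comm]

/-- Balls shrinking to a point have a null intersection, so their `|f|`-mass tends to zero. -/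
lemma exists_setIntegral_ball_le {f : R4 → ℝ} (hf : Integrable f) (x₀ : R4) {η : ℝ} (hη : 0 < η) :
    ∃ δ > 0, ∫ y in Metric.ball x₀ (2 * δ), |f y| ≤ η := by
  have hlim : Tendsto (fun n : ℕ => ∫ y in Metric.ball x₀ (1 / ((n : ℝ) + 1)), |f y|) atTop
      (𝓝 (∫ y in ⋂ n : ℕ, Metric.ball x₀ (1 / ((n : ℝ) + 1)), |f y|)) :=
    tendsto_setIntegral_of_antitone (fun _ => Metric.isOpen_ball.measurableSet)
      (fun i j hij => Metric.ball_subset_ball (by gcongr)) ⟨0, hf.abs.integrableOn⟩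
  have hs : ⋂ n : ℕ, Metric.ball x₀ (1 / ((n : ℝ) + 1)) = {x₀} := by
    ext y
    simp only [Set.mem_iInter, Metric.mem_ball, Set.mem_singleton_iff]
    refine ⟨fun h => dist_le_zero.1 (ge_of_tendsto' tendsto_one_div_add_atTop_nhds_zero_nat
      fun n => (h n).le), ?_⟩
    rintro rfl n
    rw [dist_self]
    positivity
  rw [hs, Measure.restrict_singleton] at hlim
  simp only [measure_singleton, zero_smul, integral_zero_measure] at hlim
  obtain ⟨n, hn⟩ := (hlim.eventually (gt_mem_nhds hη)).exists
  refine ⟨1 / ((n : ℝ) + 1) / 2, by positivity, ?_⟩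
  rw [mul_div_cancel₀ _ two_ne_zero]
  exact hn.le

/-- A Brezis–Merle type estimate: `exp (8 u)` is locally integrable for the logarithmic potential
`u` of an `L¹` density. -/
lemma locallyIntegrable_exp_logPot {f : R4 → ℝ} (hf : Integrable f)
    (hm : Integrable fun y => negLog ‖y‖ * f y) (c : ℝ) :
    LocallyIntegrable (fun x => exp (8 * logPot f c 0 x)) volume := by
  intro x₀
  -- The prefactor of `8 * logPot` is `1 / π²`. Mass at most `π²` therefore makes the singular
  -- exponent at most a weighted mean of `negLog ‖x - y‖`, to which Jensen applies.
  obtain ⟨δ, hδ, hsmall⟩ := exists_setIntegral_ball_le hf x₀ (η := π ^ 2) (by positivity)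
  set B := Metric.ball x₀ (2 * δ) with hB
  have hBm : MeasurableSet B := Metric.isOpen_ball.measurableSet
  set w : R4 → ℝ := B.indicator fun y => |f y| with hw
  have hw0 : ∀ y, 0 ≤ w y := Set.indicator_nonneg fun _ _ => abs_nonneg _
  have hwle : ∀ y, w y ≤ |f y| := fun y => Set.indicator_le_self' (fun _ _ => abs_nonneg _) y
  have hwi : Integrable w := hf.abs.indicator hBm
  have hws : ∫ y, w y ≤ π ^ 2 := by rwa [hw, integral_indicator hBm]
  set L := log (2 + (‖x₀‖ + δ)) + negLog δ with hL
  set C := 1 / π ^ 2 * (L * (∫ y, |f y|) + ∫ y, |negLog ‖y‖ * f y|) + 8 * c with hC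
  set a := ∫ y, w y with ha
  refine ⟨Metric.ball x₀ δ, Metric.ball_mem_nhds _ hδ, ?_⟩
  have hconv := integrable_truncKernel_conv hf
  have hbound : IntegrableOn (fun x => exp C * (1 + a⁻¹ * ((∫ y, |f y|) +
      ∫ y, truncKernel (x - y) * |f y|))) (Metric.ball x₀ δ) := by
    have hfin : volume (Metric.ball x₀ δ) ≠ ⊤ := Metric.isBounded_ball.measure_lt_top.ne
    exact ((integrableOn_const hfin).add (((integrableOn_const hfin).add
      hconv.integral_prod_left.integrableOn).const_mul _)).const_mul _
  refine Integrable.mono' hbound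
    (continuous_exp.comp_aestronglyMeasurable
      ((aestronglyMeasurable_logPot hf c 0).const_mul 8)).restrict ?_
  have hae := hconv.prod_right_ae
  rw [ae_restrict_iff' Metric.isOpen_ball.measurableSet]
  filter_upwards [hae] with x hx hxB
  have hxB' : ‖x - x₀‖ < δ := by simpa [dist_eq_norm] using hxB
  have hxn : ‖x‖ ≤ ‖x₀‖ + δ := by
    have := norm_add_le x₀ (x - x₀)
    rw [add_sub_cancel] at this
    linarith
  have hgm : Measurable fun y : R4 => negLog ‖x - y‖ :=
    measurable_negLog.comp (by fun_prop)
  have hgw : Integrable fun y => negLog ‖x - y‖ * w y := by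
    refine hx.mono' (hgm.aestronglyMeasurable.mul hwi.aestronglyMeasurable)
      (ae_of_all _ fun y => ?_)
    rw [norm_of_nonneg (mul_nonneg (negLog_nonneg _) (hw0 y))]
    exact mul_le_mul (negLog_le_truncKernel _) (hwle y) (hw0 y) (truncKernel_nonneg _)
  have hsum : Integrable fun y => |f y| + truncKernel (x - y) * |f y| := hf.abs.add hx
  have hepw : ∀ y, exp (negLog ‖x - y‖) * w y ≤ |f y| + truncKernel (x - y) * |f y| := by
    intro y
    rw [← one_add_mul]
    exact mul_le_mul (exp_negLog_le _) (hwle y) (hw0 y)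
      (add_nonneg zero_le_one (truncKernel_nonneg _))
  have hew : Integrable fun y => exp (negLog ‖x - y‖) * w y := by
    refine hsum.mono' ((measurable_exp.comp hgm).aestronglyMeasurable.mul
      hwi.aestronglyMeasurable) (ae_of_all _ fun y => ?_)
    rw [norm_of_nonneg (mul_nonneg (exp_pos _).le (hw0 y))]
    exact hepw y
  have hJ := exp_integral_div_le (fun y => negLog_nonneg ‖x - y‖) hw0 hwi hgw hew hws
  have hI2 : ∫ y, exp (negLog ‖x - y‖) * w y ≤
      (∫ y, |f y|) + ∫ y, truncKernel (x - y) * |f y| := by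
    rw [← integral_add hf.abs hx]
    exact integral_mono hew hsum hepw
  -- Only the mass `w` near `x₀` meets the singularity at `y = x`: outside the ball of radius `2δ`
  -- one has `|x - y| ≥ δ`, and the kernel is bounded through `negLog δ`.
  have hI1 : ∫ y, logKernel 0 x y * f y ≤
      L * (∫ y, |f y|) + (∫ y, |negLog ‖y‖ * f y|) + ∫ y, negLog ‖x - y‖ * w y := by
    have hbi₀ : Integrable fun y => L * |f y| + |negLog ‖y‖ * f y| :=
      (hf.abs.const_mul _).add hm.abs
    have hbi : Integrable fun y => L * |f y| + |negLog ‖y‖ * f y| + negLog ‖x - y‖ * w y :=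
      hbi₀.add hgw
    have : ‖∫ y, logKernel 0 x y * f y‖ ≤
        ∫ y, L * |f y| + |negLog ‖y‖ * f y| + negLog ‖x - y‖ * w y := by
      refine norm_integral_le_of_norm_le hbi ?_
      filter_upwards [ae_ne_pair x] with y hy
      have hk := abs_logKernel_le (ε := 0) (by simp) hy.1 hy.2
      have hlog : log (2 + ‖x‖) ≤ log (2 + (‖x₀‖ + δ)) :=
        log_le_log (by positivity) (by linarith)
      rw [norm_mul, norm_eq_abs, norm_eq_abs, abs_mul (negLog _), abs_of_nonneg (negLog_nonneg ‖y‖)]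
      have hfy := abs_nonneg (f y)
      by_cases hyB : y ∈ B
      · have hwy : w y = |f y| := Set.indicator_of_mem hyB _
        rw [hwy, ← add_mul, ← add_mul]
        refine mul_le_mul_of_nonneg_right ?_ hfy
        linarith [negLog_nonneg δ]
      · have hwy : w y = 0 := Set.indicator_of_notMem hyB _
        have hd : δ ≤ ‖x - y‖ := by
          have h2 : 2 * δ ≤ ‖y - x₀‖ := by simpa [hB, dist_eq_norm] using hyB
          have h3 := norm_sub_le (x - x₀) (x - y)
          have h4 : x - x₀ - (x - y) = y - x₀ := by abel
          rw [h4] at h3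
          linarith
        rw [hwy, mul_zero, add_zero, ← add_mul]
        refine mul_le_mul_of_nonneg_right ?_ hfy
        linarith [negLog_anti hδ hd]
    rw [integral_add hbi₀ hgw, integral_add (hf.abs.const_mul _) hm.abs,
      integral_const_mul] at this
    exact (le_abs_self _).trans this
  have hexp : 8 * logPot f c 0 x ≤ C + (∫ y, negLog ‖x - y‖ * w y) / π ^ 2 := by
    have hp2 : 0 < π ^ 2 := by positivity
    have e1 : 8 * logPot f c 0 x = 1 / π ^ 2 * (∫ y, logKernel 0 x y * f y) + 8 * c := by
      rw [logPot]
      field_simp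
    have := mul_le_mul_of_nonneg_left hI1 (by positivity : 0 ≤ 1 / π ^ 2)
    rw [e1, hC]
    calc _ ≤ _ := add_le_add_left this (8 * c)
      _ = _ := by ring
  rw [norm_of_nonneg (exp_pos _).le]
  calc exp (8 * logPot f c 0 x) ≤ exp (C + (∫ y, negLog ‖x - y‖ * w y) / π ^ 2) :=
        exp_le_exp.2 hexp
    _ = exp C * exp ((∫ y, negLog ‖x - y‖ * w y) / π ^ 2) := exp_add _ _
    _ ≤ _ := by
      refine mul_le_mul_of_nonneg_left (hJ.trans ?_) (exp_pos _).le
      have : 0 ≤ a⁻¹ := inv_nonneg.2 (integral_nonneg hw0)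
      gcongr

/-! ### Local square integrability of the density and bounds on the potential -/

lemma measurable_curvK (p : ℝ) : Measurable (curvK p) :=
  measurable_const.sub (measurable_norm.pow_const p)

lemma abs_curvK_le {p : ℝ} (hp : 0 < p) {R : ℝ} {x : R4} (hx : ‖x‖ ≤ R) :
    |curvK p x| ≤ 1 + R ^ p := by
  have h0 : 0 ≤ ‖x‖ ^ p := by positivity
  have h1 : ‖x‖ ^ p ≤ R ^ p := rpow_le_rpow (norm_nonneg x) hx hp.le
  rw [curvK, abs_le]
  constructor <;> linarith

/-- The square of the density is `K² e^{8u}`, with `K` bounded on balls; hence the exponent `8` in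
the Brezis–Merle estimate. -/
lemma integrableOn_sq_of_eq_curvK_mul_exp {p : ℝ} (hp : 0 < p) {f : R4 → ℝ} (hf : Integrable f)
    (hm : Integrable fun y => negLog ‖y‖ * f y) {c : ℝ}
    (hfe : f =ᵐ[volume] fun x => curvK p x * exp (4 * logPot f c 0 x)) (R : ℝ) :
    IntegrableOn (fun x => f x ^ 2) (Metric.closedBall 0 R) := by
  have h := (locallyIntegrable_exp_logPot hf hm c).integrableOn_isCompact
    (isCompact_closedBall (0 : R4) R)
  refine Integrable.mono' (h.const_mul ((1 + R ^ p) ^ 2))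
    (hf.aestronglyMeasurable.pow 2).restrict ?_
  rw [ae_restrict_iff' Metric.isClosed_closedBall.measurableSet]
  filter_upwards [hfe] with x hx hxR
  have hK := abs_curvK_le hp (mem_closedBall_zero_iff.1 hxR)
  have e : exp (8 * logPot f c 0 x) = exp (4 * logPot f c 0 x) ^ 2 := by
    rw [← exp_nat_mul]
    congr 1
    push_cast
    ring
  rw [norm_of_nonneg (sq_nonneg _), hx, mul_pow, e]
  refine mul_le_mul_of_nonneg_right ?_ (sq_nonneg _)
  rw [← sq_abs]
  exact pow_le_pow_left₀ (abs_nonneg _) hK 2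

/-- The Riesz potential `∫ |f(y)| / |x - y| dy` converges everywhere and is locally bounded. -/
def HasLocallyBoundedRiesz (f : R4 → ℝ) : Prop :=
  ∀ R : ℝ, ∃ M : ℝ, ∀ x : R4, ‖x‖ ≤ R →
    Integrable (fun y => ‖x - y‖⁻¹ * |f y|) ∧ ∫ y, ‖x - y‖⁻¹ * |f y| ≤ M

/-- For `|x - y| < 1` use `ab ≤ a² + b²`, which leaves the integrable `|x - y|⁻²` and `f²` on the
ball of radius `R + 1`. Otherwise the kernel is at most `1`. -/
lemma hasLocallyBoundedRiesz_of_sq {f : R4 → ℝ} (hf : Integrable f)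
    (h2 : ∀ R : ℝ, IntegrableOn (fun x => f x ^ 2) (Metric.closedBall 0 R)) :
    HasLocallyBoundedRiesz f := by
  intro R
  set B := Metric.closedBall (0 : R4) (R + 1)
  have hB : MeasurableSet B := Metric.isClosed_closedBall.measurableSet
  have hsq : Integrable (B.indicator fun x => f x ^ 2) := (h2 (R + 1)).integrable_indicator hB
  refine ⟨(∫ y, |f y|) + (∫ y, B.indicator (fun x => f x ^ 2) y) + ∫ y, truncKernel y, ?_⟩
  intro x hx
  have hk : Integrable fun y => truncKernel (x - y) := integrable_truncKernel.comp_sub_left x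
  have hb₀ : Integrable fun y => |f y| + B.indicator (fun x => f x ^ 2) y := hf.abs.add hsq
  have hb : Integrable fun y => |f y| + B.indicator (fun x => f x ^ 2) y + truncKernel (x - y) :=
    hb₀.add hk
  have hle : ∀ y, ‖x - y‖⁻¹ * |f y| ≤
      |f y| + B.indicator (fun x => f x ^ 2) y + truncKernel (x - y) := by
    intro y
    have hfy := abs_nonneg (f y)
    rcases lt_or_ge ‖x - y‖ 1 with h | h
    · have hyB : y ∈ B := by
        rw [mem_closedBall_zero_iff]
        have := norm_sub_le x (x - y)
        rw [sub_sub_cancel] at this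
        linarith
      rw [Set.indicator_of_mem hyB, truncKernel_of_lt h, ← inv_pow, ← sq_abs (f y)]
      nlinarith [sq_nonneg (‖x - y‖⁻¹ - |f y|), sq_nonneg (‖x - y‖⁻¹), sq_nonneg (|f y|)]
    · have h1 := mul_le_mul_of_nonneg_right (inv_le_one_of_one_le₀ h) hfy
      have h3 : 0 ≤ B.indicator (fun x => f x ^ 2) y :=
        Set.indicator_nonneg (fun _ _ => sq_nonneg _) y
      linarith [truncKernel_nonneg (x - y)]
  have hi : Integrable fun y => ‖x - y‖⁻¹ * |f y| := by
    refine hb.mono' (Measurable.aestronglyMeasurable (by fun_prop) |>.mul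
      hf.abs.aestronglyMeasurable) (ae_of_all _ fun y => ?_)
    rw [norm_of_nonneg (by positivity)]
    exact hle y
  refine ⟨hi, (integral_mono hi hb hle).trans_eq ?_⟩
  rw [integral_add hb₀ hk, integral_add hf.abs hsq, integral_sub_left_eq_self truncKernel volume x]

/-- A majorant for the integrand of the logarithmic potential, uniform in the regularisation. -/
noncomputable def logMajorant (f : R4 → ℝ) (x y : R4) : ℝ :=
  log (2 + ‖x‖) * |f y| + |negLog ‖y‖ * f y| + ‖x - y‖⁻¹ * |f y|

lemma norm_logKernel_mul_le (f : R4 → ℝ) {ε : ℝ} (hε : |ε| ≤ 1) (x : R4) :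
    ∀ᵐ y : R4 ∂volume, ‖logKernel ε x y * f y‖ ≤ logMajorant f x y := by
  filter_upwards [ae_ne_pair x] with y hy
  have hk := abs_logKernel_le hε hy.1 hy.2
  rw [logMajorant, norm_mul, norm_eq_abs, norm_eq_abs, abs_mul (negLog _),
    abs_of_nonneg (negLog_nonneg ‖y‖), ← add_mul, ← add_mul]
  refine mul_le_mul_of_nonneg_right ?_ (abs_nonneg _)
  linarith [negLog_le_inv (norm_nonneg (x - y))]

lemma integrable_logMajorant {f : R4 → ℝ} (hf : Integrable f)
    (hm : Integrable fun y => negLog ‖y‖ * f y) (hr : HasLocallyBoundedRiesz f) (x : R4) :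
    Integrable (logMajorant f x) := by
  obtain ⟨M, hM⟩ := hr ‖x‖
  exact ((hf.abs.const_mul _).add hm.abs).add (hM x le_rfl).1

lemma integrable_logKernel_mul {f : R4 → ℝ} (hf : Integrable f)
    (hm : Integrable fun y => negLog ‖y‖ * f y) (hr : HasLocallyBoundedRiesz f) {ε : ℝ}
    (hε : |ε| ≤ 1) (x : R4) :
    Integrable fun y => logKernel ε x y * f y :=
  (integrable_logMajorant hf hm hr x).mono'
    (((measurable_logKernel ε).comp measurable_prodMk_left).aestronglyMeasurable.mul
      hf.aestronglyMeasurable) (norm_logKernel_mul_le f hε x)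

lemma exists_abs_logPot_le {f : R4 → ℝ} (hf : Integrable f)
    (hm : Integrable fun y => negLog ‖y‖ * f y) (hr : HasLocallyBoundedRiesz f) (c R : ℝ) :
    ∃ C : ℝ, ∀ x : R4, ‖x‖ ≤ R → ∀ ε : ℝ, |ε| ≤ 1 → |logPot f c ε x| ≤ C := by
  obtain ⟨M, hM⟩ := hr R
  refine ⟨1 / (8 * π ^ 2) * (log (2 + R) * (∫ y, |f y|) + (∫ y, |negLog ‖y‖ * f y|) + M) + |c|, ?_⟩
  intro x hx ε hε
  obtain ⟨hi, hle⟩ := hM x hx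
  have h₀ : Integrable fun y => log (2 + ‖x‖) * |f y| + |negLog ‖y‖ * f y| :=
    (hf.abs.const_mul _).add hm.abs
  have h1 : |∫ y, logKernel ε x y * f y| ≤ ∫ y, logMajorant f x y :=
    norm_integral_le_of_norm_le (integrable_logMajorant hf hm hr x) (norm_logKernel_mul_le f hε x)
  have h2 : ∫ y, logMajorant f x y = log (2 + ‖x‖) * (∫ y, |f y|) + (∫ y, |negLog ‖y‖ * f y|) +
      ∫ y, ‖x - y‖⁻¹ * |f y| := by
    simp only [logMajorant]
    rw [integral_add h₀ hi, integral_add (hf.abs.const_mul _) hm.abs, integral_const_mul]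
  have h3 : log (2 + ‖x‖) * (∫ y, |f y|) ≤ log (2 + R) * (∫ y, |f y|) :=
    mul_le_mul_of_nonneg_right (log_le_log (by positivity) (by linarith))
      (integral_nonneg fun _ => abs_nonneg _)
  rw [logPot]
  refine (abs_add_le _ _).trans (add_le_add_left ?_ _)
  rw [abs_mul, abs_of_nonneg (by positivity : 0 ≤ 1 / (8 * π ^ 2))]
  exact mul_le_mul_of_nonneg_left (by linarith) (by positivity)

lemma tendsto_logPot {f : R4 → ℝ} (hf : Integrable f)
    (hm : Integrable fun y => negLog ‖y‖ * f y) (hr : HasLocallyBoundedRiesz f) (c : ℝ) (x : R4) :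
    Tendsto (fun ε => logPot f c ε x) (𝓝[>] 0) (𝓝 (logPot f c 0 x)) := by
  refine Tendsto.add_const _ (Tendsto.const_mul _ ?_)
  refine tendsto_integral_filter_of_dominated_convergence (logMajorant f x)
    (Eventually.of_forall fun ε => ((measurable_logKernel ε).comp
      measurable_prodMk_left).aestronglyMeasurable.mul hf.aestronglyMeasurable) ?_
    (integrable_logMajorant hf hm hr x) ?_
  · filter_upwards [Ioo_mem_nhdsGT (zero_lt_one' ℝ)] with ε hε
    exact norm_logKernel_mul_le f (abs_le.2 ⟨by linarith [hε.1], hε.2.le⟩) x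
  · filter_upwards [ae_ne_pair x] with y hy
    refine Tendsto.mul_const _ ?_
    have hne : ‖x - y‖ ^ 2 + (0 : ℝ) ^ 2 ≠ 0 := by
      have : 0 < ‖x - y‖ := norm_pos_iff.2 (sub_ne_zero.2 hy.2.symm)
      positivity
    have hc : ContinuousAt (fun ε : ℝ => logKernel ε x y) 0 := by
      unfold logKernel
      have hq : ContinuousAt (fun ε : ℝ => ‖x - y‖ ^ 2 + ε ^ 2) 0 := by fun_prop
      exact continuousAt_const.sub ((hq.log hne).div_const 2)
    exact hc.tendsto.mono_left nhdsWithin_le_nhds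

/-! ### Radial derivative of the regularised potential -/

/-- The radial derivative `x · ∇` of the (regularised) logarithmic potential of `f`. -/
noncomputable def radialDerivPot (f : R4 → ℝ) (ε : ℝ) (x : R4) : ℝ :=
  -(1 / (8 * π ^ 2)) * ∫ y, inner ℝ x (x - y) / (‖x - y‖ ^ 2 + ε ^ 2) * f y

lemma measurable_inner_div (ε : ℝ) :
    Measurable fun q : R4 × R4 => inner ℝ q.1 (q.1 - q.2) / (‖q.1 - q.2‖ ^ 2 + ε ^ 2) := by
  have h : Measurable fun q : R4 × R4 => inner ℝ q.1 (q.1 - q.2) :=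
    (by fun_prop : Continuous fun q : R4 × R4 => inner ℝ q.1 (q.1 - q.2)).measurable
  exact h.div (by fun_prop)

lemma aestronglyMeasurable_radialDerivPot {f : R4 → ℝ} (hf : Integrable f) (ε : ℝ) :
    AEStronglyMeasurable (radialDerivPot f ε) volume := by
  have h : AEStronglyMeasurable (fun q : R4 × R4 =>
      inner ℝ q.1 (q.1 - q.2) / (‖q.1 - q.2‖ ^ 2 + ε ^ 2) * f q.2) (volume.prod volume) :=
    (measurable_inner_div ε).aestronglyMeasurable.mul hf.aestronglyMeasurable.comp_snd
  exact h.integral_prod_right'.const_mul _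

lemma abs_inner_div_le (ε : ℝ) (x z : R4) :
    |inner ℝ x z / (‖z‖ ^ 2 + ε ^ 2)| ≤ ‖x‖ * ‖z‖⁻¹ := by
  rcases eq_or_ne z 0 with rfl | hz
  · simp
  have hz0 : 0 < ‖z‖ := norm_pos_iff.2 hz
  rw [abs_div, abs_of_pos (by positivity : 0 < ‖z‖ ^ 2 + ε ^ 2), ← div_eq_mul_inv,
    div_le_div_iff₀ (by positivity) hz0]
  have h1 := abs_real_inner_le_norm x z
  calc |inner ℝ x z| * ‖z‖ ≤ ‖x‖ * ‖z‖ * ‖z‖ := by gcongr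
    _ ≤ ‖x‖ * (‖z‖ ^ 2 + ε ^ 2) := by
      nlinarith [norm_nonneg x, mul_nonneg (norm_nonneg x) (sq_nonneg ε)]

lemma abs_inner_div_le_of_pos {ε : ℝ} (hε : 0 < ε) (x z : R4) :
    |inner ℝ x z / (‖z‖ ^ 2 + ε ^ 2)| ≤ ‖x‖ * ε⁻¹ := by
  rw [abs_div, abs_of_pos (by positivity : 0 < ‖z‖ ^ 2 + ε ^ 2), ← div_eq_mul_inv,
    div_le_div_iff₀ (by positivity) hε]
  have h1 := abs_real_inner_le_norm x z
  calc |inner ℝ x z| * ε ≤ ‖x‖ * ‖z‖ * ε := by gcongr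
    _ = ‖x‖ * (‖z‖ * ε) := by ring
    _ ≤ ‖x‖ * (‖z‖ ^ 2 + ε ^ 2) := by
      gcongr
      nlinarith [sq_nonneg (‖z‖ - ε), sq_nonneg ‖z‖, sq_nonneg ε]

lemma exists_abs_radialDerivPot_le {f : R4 → ℝ} (hr : HasLocallyBoundedRiesz f) (R : ℝ) :
    ∃ C : ℝ, ∀ x : R4, ‖x‖ ≤ R → ∀ ε : ℝ, |radialDerivPot f ε x| ≤ C := by
  obtain ⟨M, hM⟩ := hr R
  refine ⟨1 / (8 * π ^ 2) * (R * M), fun x hx ε => ?_⟩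
  obtain ⟨hi, hle⟩ := hM x hx
  have h : |∫ y, inner ℝ x (x - y) / (‖x - y‖ ^ 2 + ε ^ 2) * f y| ≤
      ∫ y, ‖x‖ * (‖x - y‖⁻¹ * |f y|) := by
    rw [← norm_eq_abs]
    refine norm_integral_le_of_norm_le (hi.const_mul _) (ae_of_all _ fun y => ?_)
    rw [norm_mul, ← mul_assoc]
    exact mul_le_mul_of_nonneg_right (abs_inner_div_le ε x (x - y)) (norm_nonneg _)
  rw [integral_const_mul] at h
  rw [radialDerivPot, abs_mul, abs_neg, abs_of_nonneg (by positivity : 0 ≤ 1 / (8 * π ^ 2))]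
  refine mul_le_mul_of_nonneg_left (h.trans ?_) (by positivity)
  exact mul_le_mul hx hle (integral_nonneg fun y => by positivity) ((norm_nonneg x).trans hx)

lemma tendsto_radialDerivPot {f : R4 → ℝ} (hf : Integrable f) (hr : HasLocallyBoundedRiesz f)
    (x : R4) : Tendsto (fun ε => radialDerivPot f ε x) (𝓝[>] 0) (𝓝 (radialDerivPot f 0 x)) := by
  obtain ⟨M, hM⟩ := hr ‖x‖
  refine Tendsto.const_mul _ ?_
  refine tendsto_integral_filter_of_dominated_convergence (fun y => ‖x‖ * (‖x - y‖⁻¹ * |f y|))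
    (Eventually.of_forall fun ε => ((measurable_inner_div ε).comp
      measurable_prodMk_left).aestronglyMeasurable.mul hf.aestronglyMeasurable)
    (Eventually.of_forall fun ε => ae_of_all _ fun y => ?_) ((hM x le_rfl).1.const_mul _) ?_
  · rw [norm_mul, ← mul_assoc]
    exact mul_le_mul_of_nonneg_right (abs_inner_div_le ε x (x - y)) (norm_nonneg _)
  · filter_upwards [ae_ne_pair x] with y hy
    refine Tendsto.mul_const _ ?_
    have hne : ‖x - y‖ ^ 2 + (0 : ℝ) ^ 2 ≠ 0 := by
      have : 0 < ‖x - y‖ := norm_pos_iff.2 (sub_ne_zero.2 hy.2.symm)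
      positivity
    have hc : ContinuousAt (fun ε : ℝ => inner ℝ x (x - y) / (‖x - y‖ ^ 2 + ε ^ 2)) 0 :=
      continuousAt_const.div (by fun_prop) hne
    exact hc.tendsto.mono_left nhdsWithin_le_nhds

lemma hasDerivAt_logKernel_smul {ε : ℝ} (hε : 0 < ε) (x y : R4) (t : ℝ) :
    HasDerivAt (fun t : ℝ => logKernel ε (t • x) y)
      (-(inner ℝ x (t • x - y) / (‖t • x - y‖ ^ 2 + ε ^ 2))) t := by
  have h1 : HasDerivAt (fun t : ℝ => t • x - y) x t := by
    simpa using ((hasDerivAt_id t).smul_const x).sub_const y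
  have h2 := (h1.norm_sq.add_const (ε ^ 2)).log (by positivity)
  have h3 := (h2.div_const 2).const_sub (log ‖y‖)
  refine h3.congr_deriv ?_
  rw [real_inner_comm]
  ring

/-- With `ε > 0` the `t`-derivative of the kernel is at most `‖x‖ / ε` for all `t` and `y`, so one
may differentiate under the integral. Dividing by `t` converts `x · ∇` at `t • x` into `d/dt`. -/
lemma hasDerivAt_logPot_smul {f : R4 → ℝ} (hf : Integrable f)
    (hm : Integrable fun y => negLog ‖y‖ * f y) (hr : HasLocallyBoundedRiesz f) (c : ℝ) {ε : ℝ}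
    (hε : 0 < ε) (hε1 : ε ≤ 1) (x : R4) {t : ℝ} (ht : t ≠ 0) :
    HasDerivAt (fun t : ℝ => logPot f c ε (t • x)) (radialDerivPot f ε (t • x) / t) t := by
  have key := (hasDerivAt_integral_of_dominated_loc_of_deriv_le (μ := (volume : Measure R4))
    (F := fun (t : ℝ) y => logKernel ε (t • x) y * f y) (x₀ := t) (s := Set.univ)
    (F' := fun (t : ℝ) y => -(inner ℝ x (t • x - y) / (‖t • x - y‖ ^ 2 + ε ^ 2)) * f y)
    (bound := fun y => ‖x‖ * ε⁻¹ * |f y|) univ_mem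
    (Eventually.of_forall fun t => ((measurable_logKernel ε).comp
      measurable_prodMk_left).aestronglyMeasurable.mul hf.aestronglyMeasurable)
    (integrable_logKernel_mul hf hm hr (abs_le.2 ⟨by linarith, hε1⟩) _)
    ?_ (ae_of_all _ fun y t _ => ?_) (hf.abs.const_mul _)
    (ae_of_all _ fun y t _ => (hasDerivAt_logKernel_smul hε x y t).mul_const _)).2
  · refine ((key.const_mul (1 / (8 * π ^ 2))).add_const c).congr_deriv ?_
    rw [radialDerivPot]
    simp only [neg_mul, integral_neg, inner_smul_left, conj_trivial, mul_div_assoc, mul_assoc,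
      integral_const_mul]
    field_simp
  · have h : Continuous fun y : R4 => inner ℝ x (t • x - y) := by fun_prop
    exact ((h.measurable.div (by fun_prop)).neg).aestronglyMeasurable.mul hf.aestronglyMeasurable
  · rw [norm_mul, norm_neg]
    exact mul_le_mul_of_nonneg_right (abs_inner_div_le_of_pos hε x _) (norm_nonneg _)

/-! ### The Pohozaev identity -/

/-- The dilation identity `∫ (4 h + x · ∇h) = 0` on `ℝ⁴`. -/
lemma integral_four_mul_add_radialDeriv {h h' : R4 → ℝ} {ρ C : ℝ}
    (hm : AEStronglyMeasurable h volume) (hm' : AEStronglyMeasurable h' volume)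
    (hC : ∀ x, |h x| ≤ (Metric.closedBall (0 : R4) ρ).indicator (fun _ => C) x)
    (hC' : ∀ x, |h' x| ≤ (Metric.closedBall (0 : R4) ρ).indicator (fun _ => C) x)
    (hd : ∀ x, ∀ t : ℝ, 0 < t → HasDerivAt (fun t : ℝ => h (t • x)) (h' (t • x) / t) t) :
    ∫ x, (4 * h x + h' x) = 0 := by
  have hball : ∀ r : ℝ, Integrable ((Metric.closedBall (0 : R4) r).indicator fun _ => C) :=
    fun r => (integrableOn_const (isCompact_closedBall _ _).measure_lt_top.ne).integrable_indicator
      Metric.isClosed_closedBall.measurableSet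
  have hi : Integrable h := (hball ρ).mono' hm (ae_of_all _ hC)
  have hi' : Integrable h' := (hball ρ).mono' hm' (ae_of_all _ hC')
  -- Differentiate `∫ h (t • x) dx = t⁻⁴ ∫ h` at `t = 1`. For `t > 1/2` the derivatives are
  -- supported in the ball of radius `2ρ` and bounded by `2C`.
  have key := (hasDerivAt_integral_of_dominated_loc_of_deriv_le (μ := (volume : Measure R4))
    (F := fun (t : ℝ) x => h (t • x)) (x₀ := 1) (s := Set.Ioi (1 / 2))
    (F' := fun (t : ℝ) x => h' (t • x) / t)
    (bound := fun x => 2 * (Metric.closedBall (0 : R4) (2 * ρ)).indicator (fun _ => C) x)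
    (Ioi_mem_nhds (by norm_num)) ?_ (by simpa using hi) (by simpa using hm')
    (ae_of_all _ fun x t ht => ?_) ((hball _).const_mul 2)
    (ae_of_all _ fun x t ht => hd x t (lt_trans (by norm_num) ht))).2
  · have e : (fun t : ℝ => ∫ x, h (t • x)) =ᶠ[𝓝 1] fun t => (t ^ 4)⁻¹ * ∫ x, h x := by
      filter_upwards [lt_mem_nhds (zero_lt_one' ℝ)] with t ht
      rw [Measure.integral_comp_smul]
      simp [abs_of_pos (by positivity : 0 < (t ^ 4)⁻¹)]
    have h2 : HasDerivAt (fun t : ℝ => (t ^ 4)⁻¹ * ∫ x, h x) (-4 * ∫ x, h x) 1 := by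
      refine (((hasDerivAt_pow 4 (1 : ℝ)).inv (by norm_num)).mul_const _).congr_deriv ?_
      norm_num
    have h3 := (key.congr_of_eventuallyEq e.symm).unique h2
    simp only [one_smul, div_one] at h3
    rw [integral_add (hi.const_mul 4) hi', integral_const_mul, h3]
    ring
  · filter_upwards [lt_mem_nhds (zero_lt_one' ℝ)] with t ht
    exact (hi.comp_smul ht.ne').aestronglyMeasurable
  · have ht0 : (1 / 2 : ℝ) < t := ht
    have ht1 : 0 < t := lt_trans (by norm_num) ht0
    rw [norm_div, norm_of_nonneg ht1.le, div_le_iff₀ ht1]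
    have h1 := hC' (t • x)
    have h0 := (abs_nonneg _).trans h1
    refine h1.trans ?_
    by_cases hx : t • x ∈ Metric.closedBall (0 : R4) ρ
    · have hx2 : x ∈ Metric.closedBall (0 : R4) (2 * ρ) := by
        rw [mem_closedBall_zero_iff] at hx ⊢
        rw [norm_smul, norm_of_nonneg ht1.le] at hx
        nlinarith [norm_nonneg x]
      rw [Set.indicator_of_mem hx] at h0 ⊢
      rw [Set.indicator_of_mem hx2]
      nlinarith
    · rw [Set.indicator_of_notMem hx] at h0 ⊢
      by_cases hx2 : x ∈ Metric.closedBall (0 : R4) (2 * ρ)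
      · rw [Set.indicator_of_mem hx2]
        have hC0 : 0 ≤ C := by
          have hρ : 0 ≤ ρ := by
            have := (norm_nonneg x).trans (mem_closedBall_zero_iff.1 hx2)
            linarith
          have := (abs_nonneg _).trans (hC 0)
          rwa [Set.indicator_of_mem (by simpa using hρ)] at this
        positivity
      · rw [Set.indicator_of_notMem hx2]
        simp

/-! ### Cutoff and curvature along rays -/

lemma hasDerivAt_max_zero_sq (r : ℝ) :
    HasDerivAt (fun r : ℝ => max 0 r ^ 2) (2 * max 0 r) r := by
  rcases lt_trichotomy r 0 with h | rfl | h
  · have e : (fun r : ℝ => max 0 r ^ 2) =ᶠ[𝓝 r] fun _ => 0 := by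
      filter_upwards [gt_mem_nhds h] with s hs
      simp [max_eq_left hs.le]
    rw [max_eq_left h.le, mul_zero]
    exact (hasDerivAt_const r (0 : ℝ)).congr_of_eventuallyEq e
  · have hO : (fun r : ℝ => max 0 r ^ 2) =O[𝓝 0] fun r : ℝ => ‖r - 0‖ ^ 2 := by
      refine Asymptotics.IsBigO.of_bound 1 (Eventually.of_forall fun s => ?_)
      simp only [sub_zero, norm_pow, one_mul, norm_eq_abs, abs_abs]
      rw [abs_of_nonneg (le_max_left _ _)]
      exact pow_le_pow_left₀ (le_max_left _ _) (max_le (abs_nonneg _) (le_abs_self _)) 2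
    have := (hO.hasFDerivAt (by norm_num)).hasDerivAt
    simpa using this
  · have e : (fun r : ℝ => max 0 r ^ 2) =ᶠ[𝓝 r] fun r => r ^ 2 := by
      filter_upwards [lt_mem_nhds h] with s hs
      simp [max_eq_right hs.le]
    rw [max_eq_right h.le]
    exact ((hasDerivAt_pow 2 r).congr_deriv (by norm_num)).congr_of_eventuallyEq e

/-- A radial `C¹` cutoff supported in the ball of radius `ρ`. -/
noncomputable def cutoff (ρ : ℝ) (x : R4) : ℝ := max 0 (1 - (‖x‖ / ρ) ^ 2) ^ 2

/-- The radial derivative `x · ∇` of `cutoff ρ`. -/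
noncomputable def cutoffDeriv (ρ : ℝ) (x : R4) : ℝ :=
  -4 * (‖x‖ / ρ) ^ 2 * max 0 (1 - (‖x‖ / ρ) ^ 2)

lemma continuous_cutoff (ρ : ℝ) : Continuous (cutoff ρ) := by
  unfold cutoff
  fun_prop

lemma continuous_cutoffDeriv (ρ : ℝ) : Continuous (cutoffDeriv ρ) := by
  unfold cutoffDeriv
  fun_prop

lemma cutoff_nonneg (ρ : ℝ) (x : R4) : 0 ≤ cutoff ρ x := sq_nonneg _

lemma max_zero_one_sub_sq_le (a : ℝ) : max 0 (1 - a ^ 2) ≤ 1 :=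
  max_le zero_le_one (by nlinarith [sq_nonneg a])

lemma cutoff_le_one (ρ : ℝ) (x : R4) : cutoff ρ x ≤ 1 :=
  pow_le_one₀ (le_max_left _ _) (max_zero_one_sub_sq_le _)

lemma abs_cutoff_le_one (ρ : ℝ) (x : R4) : |cutoff ρ x| ≤ 1 := by
  rw [abs_of_nonneg (cutoff_nonneg ρ x)]
  exact cutoff_le_one ρ x

lemma abs_cutoffDeriv_le (ρ : ℝ) (x : R4) : |cutoffDeriv ρ x| ≤ 4 := by
  rw [cutoffDeriv]
  set s := (‖x‖ / ρ) ^ 2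
  have hs : 0 ≤ s := sq_nonneg _
  have h0 : 0 ≤ max 0 (1 - s) := le_max_left _ _
  have : s * max 0 (1 - s) ≤ 1 := by
    rcases le_total (1 - s) 0 with h | h
    · simp [max_eq_left h]
    · rw [max_eq_right h]
      nlinarith
  rw [abs_le]
  constructor <;> nlinarith [mul_nonneg hs h0]

lemma max_zero_one_sub_eq_zero {ρ : ℝ} (hρ : 0 < ρ) {x : R4} (hx : ρ ≤ ‖x‖) :
    max 0 (1 - (‖x‖ / ρ) ^ 2) = 0 := by
  have : 1 ≤ ‖x‖ / ρ := (one_le_div hρ).2 hx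
  exact max_eq_left (by nlinarith)

lemma cutoff_eq_zero {ρ : ℝ} (hρ : 0 < ρ) {x : R4} (hx : ρ ≤ ‖x‖) : cutoff ρ x = 0 := by
  simp [cutoff, max_zero_one_sub_eq_zero hρ hx]

lemma cutoffDeriv_eq_zero {ρ : ℝ} (hρ : 0 < ρ) {x : R4} (hx : ρ ≤ ‖x‖) :
    cutoffDeriv ρ x = 0 := by
  simp [cutoffDeriv, max_zero_one_sub_eq_zero hρ hx]

lemma hasDerivAt_cutoff_smul (ρ : ℝ) (x : R4) {t : ℝ} (ht : 0 < t) :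
    HasDerivAt (fun t : ℝ => cutoff ρ (t • x)) (cutoffDeriv ρ (t • x) / t) t := by
  have e : (fun t : ℝ => cutoff ρ (t • x)) =
      fun t : ℝ => max 0 (1 - t ^ 2 * (‖x‖ / ρ) ^ 2) ^ 2 := by
    funext t
    rw [cutoff, norm_smul, mul_div_assoc, mul_pow, norm_eq_abs, sq_abs]
  have h1 : HasDerivAt (fun t : ℝ => 1 - t ^ 2 * (‖x‖ / ρ) ^ 2) (-(2 * t * (‖x‖ / ρ) ^ 2)) t := by
    simpa using ((hasDerivAt_pow 2 t).mul_const ((‖x‖ / ρ) ^ 2)).const_sub 1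
  have h2 := (hasDerivAt_max_zero_sq (1 - t ^ 2 * (‖x‖ / ρ) ^ 2)).comp t h1
  rw [e]
  refine h2.congr_deriv ?_
  have e2 : (‖t • x‖ / ρ) ^ 2 = t ^ 2 * (‖x‖ / ρ) ^ 2 := by
    rw [norm_smul, mul_div_assoc, mul_pow, norm_eq_abs, sq_abs]
  rw [cutoffDeriv, e2]
  field_simp
  ring

lemma hasDerivAt_curvK_smul (p : ℝ) (x : R4) {t : ℝ} (ht : 0 < t) :
    HasDerivAt (fun t : ℝ => curvK p (t • x)) (-(p * ‖t • x‖ ^ p) / t) t := by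
  have e : (fun t : ℝ => curvK p (t • x)) =ᶠ[𝓝 t] fun t => 1 - t ^ p * ‖x‖ ^ p := by
    filter_upwards [lt_mem_nhds ht] with s hs
    rw [curvK, norm_smul, norm_of_nonneg hs.le, mul_rpow hs.le (norm_nonneg x)]
  have h := ((hasDerivAt_rpow_const (p := p) (Or.inl ht.ne')).mul_const (‖x‖ ^ p)).const_sub 1
  refine (h.congr_of_eventuallyEq e).congr_deriv ?_
  rw [norm_smul, norm_of_nonneg ht.le, mul_rpow ht.le (norm_nonneg x), rpow_sub_one ht.ne']
  ring

/-- The difference quotients of the vector field `cutoff ρ x • x` are bounded uniformly in `ρ`. -/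
lemma norm_cutoff_smul_sub_le {ρ : ℝ} (hρ : 0 < ρ) (x y : R4) :
    ‖cutoff ρ x • x - cutoff ρ y • y‖ ≤ 5 * ‖x - y‖ := by
  wlog hxy : ‖y‖ ≤ ‖x‖ generalizing x y with H
  · rw [norm_sub_rev, norm_sub_rev x]
    exact H y x (le_of_not_ge hxy)
  -- With `‖y‖ ≤ ‖x‖`, the difference of cutoffs is attached to the shorter vector, which makes it
  -- vanish when both points lie outside the support.
  have e : cutoff ρ x • x - cutoff ρ y • y =
      cutoff ρ x • (x - y) - (cutoff ρ y - cutoff ρ x) • y := by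
    rw [smul_sub, sub_smul]
    abel
  set a := ‖x‖ / ρ with ha
  set b := ‖y‖ / ρ with hb
  have hb0 : 0 ≤ b := by positivity
  have hba : b ≤ a := div_le_div_of_nonneg_right hxy hρ.le
  -- A scale-invariant bound in `a = ‖x‖ / ρ` and `b = ‖y‖ / ρ`; this is why the final constant does
  -- not depend on `ρ`.
  have key : |cutoff ρ y - cutoff ρ x| * b ≤ 4 * (a - b) := by
    rw [cutoff, cutoff, ← ha, ← hb]
    rcases le_or_gt 1 b with h1 | h1
    · rw [max_eq_left (by nlinarith : 1 - a ^ 2 ≤ 0), max_eq_left (by nlinarith : 1 - b ^ 2 ≤ 0)]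
      simp only [sub_self, abs_zero, zero_mul]
      linarith
    have hB : 0 ≤ 1 - b ^ 2 := by nlinarith
    have hB1 : 1 - b ^ 2 ≤ 1 := by nlinarith
    have hB2 : 1 - b ^ 2 ≤ 2 * (1 - b) := by nlinarith
    rw [max_eq_right hB]
    rcases le_or_gt 1 a with h2 | h2
    · rw [max_eq_left (by nlinarith : 1 - a ^ 2 ≤ 0)]
      rw [zero_pow two_ne_zero, sub_zero, abs_of_nonneg (sq_nonneg _)]
      have h3 : (1 - b ^ 2) ^ 2 ≤ 2 * (1 - b) := by nlinarith
      nlinarith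
    · have hA : 0 ≤ 1 - a ^ 2 := by nlinarith
      rw [max_eq_right hA]
      have e2 : (1 - b ^ 2) ^ 2 - (1 - a ^ 2) ^ 2 = (a - b) * ((a + b) * (2 - a ^ 2 - b ^ 2)) := by
        ring
      have h4 : 0 ≤ (a + b) * (2 - a ^ 2 - b ^ 2) :=
        mul_nonneg (by linarith) (by linarith)
      have h5 : (a + b) * (2 - a ^ 2 - b ^ 2) ≤ 4 := by nlinarith
      have h6 : 0 ≤ a - b := by linarith
      rw [e2, abs_of_nonneg (mul_nonneg h6 h4)]
      have h7 : (a + b) * (2 - a ^ 2 - b ^ 2) * b ≤ 4 := by nlinarith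
      calc _ = (a - b) * ((a + b) * (2 - a ^ 2 - b ^ 2) * b) := by ring
        _ ≤ (a - b) * 4 := by gcongr
        _ = _ := by ring
  have key2 : |cutoff ρ y - cutoff ρ x| * ‖y‖ ≤ 4 * ‖x - y‖ := by
    have h1 : ‖y‖ = b * ρ := by rw [hb, div_mul_cancel₀ _ hρ.ne']
    have h2 : (a - b) * ρ = ‖x‖ - ‖y‖ := by
      rw [ha, hb]
      field_simp
    calc |cutoff ρ y - cutoff ρ x| * ‖y‖ = |cutoff ρ y - cutoff ρ x| * b * ρ := by rw [h1]; ring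
      _ ≤ 4 * (a - b) * ρ := by gcongr
      _ = 4 * (‖x‖ - ‖y‖) := by rw [mul_assoc, h2]
      _ ≤ 4 * ‖x - y‖ := by gcongr; exact norm_sub_norm_le x y
  rw [e]
  refine (norm_sub_le _ _).trans ?_
  rw [norm_smul, norm_smul, norm_eq_abs, norm_eq_abs]
  have := mul_le_mul_of_nonneg_right (abs_cutoff_le_one ρ x) (norm_nonneg (x - y))
  linarith

/-! ### The dilation identity at fixed cutoff radius -/

/-- The integrand `4 h + x · ∇h` for `h = cutoff ρ * curvK p * exp (4 * logPot f c ε)`. -/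
noncomputable def pohozaevIntegrand (p : ℝ) (f : R4 → ℝ) (c ρ ε : ℝ) (x : R4) : ℝ :=
  ((4 * cutoff ρ x + cutoffDeriv ρ x) * curvK p x - p * cutoff ρ x * ‖x‖ ^ p +
    4 * cutoff ρ x * curvK p x * radialDerivPot f ε x) * exp (4 * logPot f c ε x)

lemma aestronglyMeasurable_pohozaevIntegrand (p : ℝ) {f : R4 → ℝ} (hf : Integrable f)
    (c ρ ε : ℝ) : AEStronglyMeasurable (pohozaevIntegrand p f c ρ ε) volume := by
  have hφ := (continuous_cutoff ρ).aestronglyMeasurable (μ := (volume : Measure R4))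
  have hψ := (continuous_cutoffDeriv ρ).aestronglyMeasurable (μ := (volume : Measure R4))
  have hK := (measurable_curvK p).aestronglyMeasurable (μ := (volume : Measure R4))
  have hn : AEStronglyMeasurable (fun x : R4 => ‖x‖ ^ p) volume :=
    (measurable_norm.pow_const p).aestronglyMeasurable
  exact (((((hφ.const_mul 4).add hψ).mul hK).sub ((hφ.const_mul p).mul hn)).add
    (((hφ.const_mul 4).mul hK).mul (aestronglyMeasurable_radialDerivPot hf ε))).mul
    (continuous_exp.comp_aestronglyMeasurable ((aestronglyMeasurable_logPot hf c ε).const_mul 4))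

lemma exists_abs_pohozaevIntegrand_le {p : ℝ} (hp : 0 < p) {f : R4 → ℝ} (hf : Integrable f)
    (hm : Integrable fun y => negLog ‖y‖ * f y) (hr : HasLocallyBoundedRiesz f) (c : ℝ) {ρ : ℝ}
    (hρ : 0 < ρ) : ∃ C : ℝ, ∀ ε : ℝ, |ε| ≤ 1 → ∀ x : R4,
      |cutoff ρ x * curvK p x * exp (4 * logPot f c ε x)| ≤
        (Metric.closedBall (0 : R4) ρ).indicator (fun _ => C) x ∧
      |pohozaevIntegrand p f c ρ ε x| ≤
        (Metric.closedBall (0 : R4) ρ).indicator (fun _ => C) x := by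
  obtain ⟨A, hA⟩ := exists_abs_logPot_le hf hm hr c ρ
  obtain ⟨D, hD⟩ := exists_abs_radialDerivPot_le hr ρ
  refine ⟨(8 * (1 + ρ ^ p) + p * ρ ^ p + 4 * (1 + ρ ^ p) * D) * exp (4 * A), fun ε hε x => ?_⟩
  by_cases hx : x ∈ Metric.closedBall (0 : R4) ρ
  · rw [Set.indicator_of_mem hx]
    rw [mem_closedBall_zero_iff] at hx
    have hK := abs_curvK_le hp hx
    have hU : exp (4 * logPot f c ε x) ≤ exp (4 * A) :=
      exp_le_exp.2 (by linarith [(abs_le.1 (hA x hx ε hε)).2])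
    have hDx := hD x hx ε
    have hD0 : 0 ≤ D := (abs_nonneg _).trans hDx
    have hR : 0 ≤ ρ ^ p := by positivity
    have hn : ‖x‖ ^ p ≤ ρ ^ p := rpow_le_rpow (norm_nonneg x) hx hp.le
    have hn0 : 0 ≤ ‖x‖ ^ p := by positivity
    have hφ := abs_cutoff_le_one ρ x
    have hψ := abs_cutoffDeriv_le ρ x
    have b1 : |(4 * cutoff ρ x + cutoffDeriv ρ x) * curvK p x| ≤ 8 * (1 + ρ ^ p) := by
      rw [abs_mul]
      refine mul_le_mul ?_ hK (abs_nonneg _) (by norm_num)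
      refine (abs_add_le _ _).trans ?_
      rw [abs_mul, abs_of_pos (by norm_num : (0 : ℝ) < 4)]
      linarith
    have b2 : |p * cutoff ρ x * ‖x‖ ^ p| ≤ p * ρ ^ p := by
      rw [abs_mul, abs_mul, abs_of_pos hp, abs_of_nonneg hn0]
      have : p * |cutoff ρ x| ≤ p := mul_le_of_le_one_right hp.le hφ
      gcongr
    have b0 : |cutoff ρ x * curvK p x| ≤ 1 + ρ ^ p := by
      rw [abs_mul]
      simpa using mul_le_mul hφ hK (abs_nonneg _) zero_le_one
    have b3 : |4 * cutoff ρ x * curvK p x * radialDerivPot f ε x| ≤ 4 * (1 + ρ ^ p) * D := by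
      rw [abs_mul, mul_assoc 4, abs_mul 4, abs_of_pos (by norm_num : (0 : ℝ) < 4)]
      gcongr
    constructor
    · rw [abs_mul, abs_of_pos (exp_pos (4 * logPot f c ε x))]
      have hpos : 0 ≤ p * ρ ^ p + 4 * (1 + ρ ^ p) * D := by positivity
      exact mul_le_mul (by linarith) hU (exp_pos _).le (by positivity)
    · rw [pohozaevIntegrand, abs_mul, abs_of_pos (exp_pos (4 * logPot f c ε x))]
      refine mul_le_mul ?_ hU (exp_pos _).le (by positivity)
      refine (abs_add_le _ _).trans (add_le_add ((abs_sub _ _).trans (add_le_add b1 b2)) b3)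
  · have hx' : ρ ≤ ‖x‖ := by
      rw [mem_closedBall_zero_iff, not_le] at hx
      exact hx.le
    rw [Set.indicator_of_notMem hx, pohozaevIntegrand, cutoff_eq_zero hρ hx',
      cutoffDeriv_eq_zero hρ hx']
    simp

lemma integral_pohozaevIntegrand_of_pos {p : ℝ} (hp : 0 < p) {f : R4 → ℝ} (hf : Integrable f)
    (hm : Integrable fun y => negLog ‖y‖ * f y) (hr : HasLocallyBoundedRiesz f) (c : ℝ) {ρ : ℝ}
    (hρ : 0 < ρ) {ε : ℝ} (hε : 0 < ε) (hε1 : ε ≤ 1) :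
    ∫ x, pohozaevIntegrand p f c ρ ε x = 0 := by
  obtain ⟨C, hC⟩ := exists_abs_pohozaevIntegrand_le hp hf hm hr c hρ
  have hC := hC ε (abs_le.2 ⟨by linarith, hε1⟩)
  set h : R4 → ℝ := fun x => cutoff ρ x * curvK p x * exp (4 * logPot f c ε x) with hh
  set h' : R4 → ℝ := fun x => pohozaevIntegrand p f c ρ ε x - 4 * h x with hh'
  have mh : AEStronglyMeasurable h volume :=
    ((continuous_cutoff ρ).aestronglyMeasurable.mul (measurable_curvK p).aestronglyMeasurable).mul
      (continuous_exp.comp_aestronglyMeasurable ((aestronglyMeasurable_logPot hf c ε).const_mul 4))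
  have mh' : AEStronglyMeasurable h' volume :=
    (aestronglyMeasurable_pohozaevIntegrand p hf c ρ ε).sub (mh.const_mul 4)
  have hCnn : ∀ x, 0 ≤ (Metric.closedBall (0 : R4) ρ).indicator (fun _ => C) x :=
    fun x => (abs_nonneg _).trans (hC x).1
  have hscale : ∀ x, (Metric.closedBall (0 : R4) ρ).indicator (fun _ => 5 * C) x =
      5 * (Metric.closedBall (0 : R4) ρ).indicator (fun _ => C) x := by
    intro x
    by_cases hx : x ∈ Metric.closedBall (0 : R4) ρ
    · rw [Set.indicator_of_mem hx, Set.indicator_of_mem hx]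
    · rw [Set.indicator_of_notMem hx, Set.indicator_of_notMem hx, mul_zero]
  -- The constant is `5 * C` because `h'` is the full integrand minus `4 * h`, each factor being
  -- bounded by `C` on the ball.
  have key := integral_four_mul_add_radialDeriv (h := h) (h' := h') (ρ := ρ) (C := 5 * C) mh mh'
    (fun x => ?_) (fun x => ?_) (fun x t ht => ?_)
  · simpa [hh'] using key
  · rw [hscale]
    linarith [(hC x).1, hCnn x]
  · rw [hscale]
    refine (abs_sub _ _).trans ?_
    rw [abs_mul, abs_of_pos (by norm_num : (0 : ℝ) < 4)]
    linarith [(hC x).1, (hC x).2]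
  · have h1 := (hasDerivAt_cutoff_smul ρ x ht).mul (hasDerivAt_curvK_smul p x ht)
    have h2 := ((hasDerivAt_logPot_smul hf hm hr c hε hε1 x ht.ne').const_mul 4).exp
    refine (h1.mul h2).congr_deriv ?_
    simp only [hh', hh, pohozaevIntegrand, Pi.mul_apply]
    field_simp
    ring

/-- Dominated convergence as `ε → 0`: the integrands are bounded uniformly in `ε` on a fixed ball.
-/
lemma integral_pohozaevIntegrand_zero {p : ℝ} (hp : 0 < p) {f : R4 → ℝ} (hf : Integrable f)
    (hm : Integrable fun y => negLog ‖y‖ * f y) (hr : HasLocallyBoundedRiesz f) (c : ℝ) {ρ : ℝ}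
    (hρ : 0 < ρ) : ∫ x, pohozaevIntegrand p f c ρ 0 x = 0 := by
  obtain ⟨C, hC⟩ := exists_abs_pohozaevIntegrand_le hp hf hm hr c hρ
  have hev : ∀ᶠ ε : ℝ in 𝓝[>] 0, 0 < ε ∧ ε ≤ 1 := by
    filter_upwards [Ioo_mem_nhdsGT (zero_lt_one' ℝ)] with ε hε
    exact ⟨hε.1, hε.2.le⟩
  have hlim : Tendsto (fun ε => ∫ x, pohozaevIntegrand p f c ρ ε x) (𝓝[>] 0)
      (𝓝 (∫ x, pohozaevIntegrand p f c ρ 0 x)) := by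
    refine tendsto_integral_filter_of_dominated_convergence
      ((Metric.closedBall (0 : R4) ρ).indicator fun _ => C)
      (Eventually.of_forall fun ε => aestronglyMeasurable_pohozaevIntegrand p hf c ρ ε) ?_
      ((integrableOn_const (isCompact_closedBall _ _).measure_lt_top.ne).integrable_indicator
        Metric.isClosed_closedBall.measurableSet) (ae_of_all _ fun x => ?_)
    · filter_upwards [hev] with ε hε
      exact ae_of_all _ fun x => (hC ε (abs_le.2 ⟨by linarith [hε.1], hε.2⟩) x).2
    · exact (tendsto_const_nhds.add ((tendsto_radialDerivPot hf hr x).const_mul _)).mul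
        ((continuous_exp.tendsto _).comp ((tendsto_logPot hf hm hr c x).const_mul 4))
  have h0 : Tendsto (fun ε => ∫ x, pohozaevIntegrand p f c ρ ε x) (𝓝[>] 0) (𝓝 0) := by
    refine tendsto_const_nhds.congr' ?_
    filter_upwards [hev] with ε hε
    exact (integral_pohozaevIntegrand_of_pos hp hf hm hr c hρ hε.1 hε.2).symm
  exact tendsto_nhds_unique hlim h0

/-! ### Symmetrisation and removal of the cutoff -/

/-- The symmetrised kernel of the cut off dilation field. -/
noncomputable def symKernel (ρ : ℝ) (x y : R4) : ℝ :=
  inner ℝ (cutoff ρ x • x - cutoff ρ y • y) (x - y) / ‖x - y‖ ^ 2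

lemma abs_symKernel_le {ρ : ℝ} (hρ : 0 < ρ) (x y : R4) : |symKernel ρ x y| ≤ 5 := by
  rcases eq_or_ne x y with rfl | hxy
  · simp [symKernel]
  have hz : 0 < ‖x - y‖ := norm_pos_iff.2 (sub_ne_zero.2 hxy)
  rw [symKernel, abs_div, abs_of_pos (by positivity : 0 < ‖x - y‖ ^ 2), div_le_iff₀ (by positivity)]
  refine (abs_real_inner_le_norm _ _).trans ?_
  nlinarith [norm_cutoff_smul_sub_le hρ x y]

/-- The weight `f x * f y` is symmetric and `x - y` is odd under exchange, so averaging the two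
orderings replaces the singular kernel by half of the bounded `symKernel`; this turns `8π²` into
`16π²`. The Riesz bound supplies the absolute convergence needed for Fubini. -/
lemma integral_cutoff_mul_radialDerivPot {f : R4 → ℝ} (hf : Integrable f)
    (hr : HasLocallyBoundedRiesz f) {ρ : ℝ} (hρ : 0 < ρ) :
    Integrable (fun x => cutoff ρ x * f x * radialDerivPot f 0 x) ∧
    ∫ x, cutoff ρ x * f x * radialDerivPot f 0 x =
      -(1 / (16 * π ^ 2)) * ∫ q : R4 × R4, symKernel ρ q.1 q.2 * (f q.1 * f q.2) := by
  set A : R4 × R4 → ℝ := fun q => cutoff ρ q.1 * f q.1 *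
    (inner ℝ q.1 (q.1 - q.2) / (‖q.1 - q.2‖ ^ 2 + (0 : ℝ) ^ 2) * f q.2) with hA
  obtain ⟨M, hM⟩ := hr ρ
  have hAm : AEStronglyMeasurable A (volume.prod volume) :=
    (((continuous_cutoff ρ).aestronglyMeasurable.mul hf.aestronglyMeasurable).comp_fst).mul
      ((measurable_inner_div 0).aestronglyMeasurable.mul hf.aestronglyMeasurable.comp_snd)
  have hin : ∀ x, ‖x‖ ≤ ρ → ∀ y, ‖A (x, y)‖ ≤ |f x| * ρ * (‖x - y‖⁻¹ * |f y|) := by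
    intro x hx y
    simp only [hA]
    rw [norm_mul, norm_mul, norm_mul, norm_eq_abs, norm_eq_abs, norm_eq_abs, norm_eq_abs]
    have h1 := abs_inner_div_le 0 x (x - y)
    have h2 := abs_cutoff_le_one ρ x
    calc _ ≤ 1 * |f x| * (‖x‖ * ‖x - y‖⁻¹ * |f y|) := by gcongr
      _ ≤ 1 * |f x| * (ρ * ‖x - y‖⁻¹ * |f y|) := by gcongr
      _ = _ := by ring
  have hout : ∀ x, ρ < ‖x‖ → ∀ y, A (x, y) = 0 := by
    intro x hx y
    simp [hA, cutoff_eq_zero hρ hx.le]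
  have hAi : Integrable A (volume.prod volume) := by
    rw [integrable_prod_iff hAm]
    constructor
    · have hs := hAm.prodMk_left
      filter_upwards [hs] with x hsx
      rcases le_or_gt ‖x‖ ρ with hx | hx
      · exact ((hM x hx).1.const_mul _).mono' hsx (ae_of_all _ (hin x hx))
      · simp [hout x hx]
    · refine (hf.abs.mul_const (ρ * |M|)).mono' hAm.norm.integral_prod_right'
        (ae_of_all _ fun x => ?_)
      rw [norm_of_nonneg (integral_nonneg fun _ => norm_nonneg _)]
      rcases le_or_gt ‖x‖ ρ with hx | hx
      · refine (integral_mono_of_nonneg (ae_of_all _ fun _ => norm_nonneg _)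
          ((hM x hx).1.const_mul (|f x| * ρ)) (ae_of_all _ (hin x hx))).trans ?_
        rw [integral_const_mul, ← mul_assoc]
        exact mul_le_mul_of_nonneg_left ((hM x hx).2.trans (le_abs_self M)) (by positivity)
      · simp only [hout x hx, norm_zero, integral_zero]
        positivity
  have hinner : ∀ x, cutoff ρ x * f x * radialDerivPot f 0 x =
      -(1 / (8 * π ^ 2)) * ∫ y, A (x, y) := by
    intro x
    simp only [hA, radialDerivPot]
    rw [integral_const_mul]
    ring
  have hswap : ∫ q : R4 × R4, A q = ∫ q : R4 × R4, A q.swap := (integral_prod_swap A).symm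
  have hsym : ∫ q : R4 × R4, symKernel ρ q.1 q.2 * (f q.1 * f q.2) =
      2 * ∫ q : R4 × R4, A q := by
    have e : ∀ q : R4 × R4, symKernel ρ q.1 q.2 * (f q.1 * f q.2) = A q + A q.swap := by
      rintro ⟨x, y⟩
      have h1 : inner ℝ y (y - x) = -inner ℝ y (x - y) := by
        rw [← inner_neg_right, neg_sub]
      simp only [hA, symKernel, Prod.fst_swap, Prod.snd_swap, norm_sub_rev y x, h1,
        inner_sub_left, real_inner_smul_left]
      ring
    simp only [e]
    rw [two_mul]
    exact (integral_add hAi hAi.swap).trans (congrArg _ hswap.symm)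
  refine ⟨?_, ?_⟩
  · simp only [hinner]
    exact hAi.integral_prod_left.const_mul _
  · simp only [hinner]
    rw [integral_const_mul, hsym]
    have : ∫ x, ∫ y, A (x, y) = ∫ q : R4 × R4, A q := (integral_prod A hAi).symm
    rw [this]
    ring

/-- Where `|x|^p ≥ 2` one has `|x|^p ≤ 2 (|x|^p - 1)`, so `2 |f|` dominates. On the remaining ball
`e^{4u} ≤ 1 + e^{8u}` suffices. -/
lemma integrable_norm_rpow_mul_exp {p : ℝ} (hp : 0 < p) {f : R4 → ℝ} (hf : Integrable f)
    (hm : Integrable fun y => negLog ‖y‖ * f y) {c : ℝ}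
    (hfe : f =ᵐ[volume] fun x => curvK p x * exp (4 * logPot f c 0 x)) :
    Integrable fun x : R4 => ‖x‖ ^ p * exp (4 * logPot f c 0 x) := by
  set R : ℝ := 2 ^ (1 / p) with hR
  have hRp : R ^ p = 2 := by
    rw [hR, ← rpow_mul zero_le_two, one_div_mul_cancel hp.ne', rpow_one]
  have hR0 : 0 ≤ R := by positivity
  set B := Metric.closedBall (0 : R4) R
  have hB : MeasurableSet B := Metric.isClosed_closedBall.measurableSet
  have h1 : IntegrableOn (fun x => 2 * (1 + exp (8 * logPot f c 0 x))) B :=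
    ((integrableOn_const (isCompact_closedBall _ _).measure_lt_top.ne).add
      ((locallyIntegrable_exp_logPot hf hm c).integrableOn_isCompact
        (isCompact_closedBall (0 : R4) R))).const_mul 2
  refine ((h1.integrable_indicator hB).add (hf.abs.const_mul 2)).mono'
    ((measurable_norm.pow_const p).aestronglyMeasurable.mul
      (continuous_exp.comp_aestronglyMeasurable
        ((aestronglyMeasurable_logPot hf c 0).const_mul 4))) ?_
  filter_upwards [hfe] with x hx
  rw [norm_of_nonneg (by positivity), Pi.add_apply]
  set E := exp (4 * logPot f c 0 x) with hE
  have hE0 : 0 < E := exp_pos _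
  by_cases hxB : x ∈ B
  · rw [Set.indicator_of_mem hxB]
    have e : exp (8 * logPot f c 0 x) = E ^ 2 := by
      rw [hE, ← exp_nat_mul]
      congr 1
      push_cast
      ring
    have hn : ‖x‖ ^ p ≤ 2 := by
      rw [← hRp]
      exact rpow_le_rpow (norm_nonneg x) (mem_closedBall_zero_iff.1 hxB) hp.le
    rw [e]
    have h2 := mul_le_mul_of_nonneg_right hn hE0.le
    nlinarith [abs_nonneg (f x), sq_nonneg (E - 1)]
  · rw [Set.indicator_of_notMem hxB, zero_add]
    have hn : 2 ≤ ‖x‖ ^ p := by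
      rw [← hRp]
      rw [mem_closedBall_zero_iff, not_le] at hxB
      exact rpow_le_rpow hR0 hxB.le hp.le
    rw [hx, curvK, abs_mul, abs_of_pos hE0, abs_of_nonpos (by linarith), ← mul_assoc]
    exact mul_le_mul_of_nonneg_right (by linarith) hE0.le

lemma pohozaev_cutoff {p : ℝ} (hp : 0 < p) {f : R4 → ℝ} (hf : Integrable f)
    (hm : Integrable fun y => negLog ‖y‖ * f y) (hr : HasLocallyBoundedRiesz f) {c : ℝ}
    (hfe : f =ᵐ[volume] fun x => curvK p x * exp (4 * logPot f c 0 x)) {ρ : ℝ} (hρ : 0 < ρ) :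
    (∫ x, (4 * cutoff ρ x + cutoffDeriv ρ x) * f x) -
      p * ∫ x, cutoff ρ x * (‖x‖ ^ p * exp (4 * logPot f c 0 x)) =
    1 / (4 * π ^ 2) * ∫ q : R4 × R4, symKernel ρ q.1 q.2 * (f q.1 * f q.2) := by
  obtain ⟨hD, hDe⟩ := integral_cutoff_mul_radialDerivPot hf hr hρ
  have hw := integrable_norm_rpow_mul_exp hp hf hm hfe
  have i1 : Integrable fun x => (4 * cutoff ρ x + cutoffDeriv ρ x) * f x := by
    refine hf.bdd_mul (c := 8) (((continuous_cutoff ρ).const_mul 4).add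
      (continuous_cutoffDeriv ρ)).aestronglyMeasurable (ae_of_all _ fun x => ?_)
    refine (norm_add_le _ _).trans ?_
    rw [norm_mul, norm_eq_abs, norm_eq_abs, norm_eq_abs, abs_of_pos (by norm_num : (0 : ℝ) < 4)]
    linarith [abs_cutoff_le_one ρ x, abs_cutoffDeriv_le ρ x]
  have i2 : Integrable fun x => cutoff ρ x * (‖x‖ ^ p * exp (4 * logPot f c 0 x)) :=
    hw.bdd_mul (c := 1) (continuous_cutoff ρ).aestronglyMeasurable
      (ae_of_all _ (abs_cutoff_le_one ρ))
  have e : ∫ x, pohozaevIntegrand p f c ρ 0 x =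
      ∫ x, ((4 * cutoff ρ x + cutoffDeriv ρ x) * f x -
        p * (cutoff ρ x * (‖x‖ ^ p * exp (4 * logPot f c 0 x))) +
        4 * (cutoff ρ x * f x * radialDerivPot f 0 x)) := by
    refine integral_congr_ae ?_
    filter_upwards [hfe] with x hx
    rw [pohozaevIntegrand, hx]
    ring
  have i12 : Integrable fun x => (4 * cutoff ρ x + cutoffDeriv ρ x) * f x -
        p * (cutoff ρ x * (‖x‖ ^ p * exp (4 * logPot f c 0 x))) := i1.sub (i2.const_mul p)
  rw [integral_pohozaevIntegrand_zero hp hf hm hr c hρ, integral_add i12 (hD.const_mul 4),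
    integral_sub i1 (i2.const_mul p), integral_const_mul, integral_const_mul, hDe] at e
  have hpi : π ≠ 0 := pi_ne_zero
  have e3 : 4 * (-(1 / (16 * π ^ 2)) * ∫ q : R4 × R4, symKernel ρ q.1 q.2 * (f q.1 * f q.2)) =
      -(1 / (4 * π ^ 2) * ∫ q : R4 × R4, symKernel ρ q.1 q.2 * (f q.1 * f q.2)) := by
    field_simp
    norm_num
  linarith

lemma tendsto_norm_div_atTop (x : R4) : Tendsto (fun ρ : ℝ => ‖x‖ / ρ) atTop (𝓝 0) :=
  tendsto_const_nhds.div_atTop tendsto_id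

lemma tendsto_cutoff (x : R4) : Tendsto (fun ρ => cutoff ρ x) atTop (𝓝 1) := by
  have hc : Continuous fun a : ℝ => max 0 (1 - a ^ 2) ^ 2 := by fun_prop
  simpa [cutoff, Function.comp_def] using (hc.tendsto 0).comp (tendsto_norm_div_atTop x)

lemma tendsto_cutoffDeriv (x : R4) : Tendsto (fun ρ => cutoffDeriv ρ x) atTop (𝓝 0) := by
  have hc : Continuous fun a : ℝ => -4 * a ^ 2 * max 0 (1 - a ^ 2) := by fun_prop
  simpa [cutoffDeriv, Function.comp_def] using (hc.tendsto 0).comp (tendsto_norm_div_atTop x)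

lemma ae_prod_ne : ∀ᵐ q : R4 × R4 ∂(volume.prod volume), q.1 ≠ q.2 := by
  have : (volume.prod volume) (Set.diagonal R4) = 0 := by
    rw [Measure.measure_prod_null measurableSet_diagonal]
    refine ae_of_all _ fun x => ?_
    have : Prod.mk x ⁻¹' Set.diagonal R4 = {x} := by
      ext y
      simp [eq_comm]
    simp only [this, measure_singleton, Pi.zero_apply]
  exact measure_eq_zero_iff_ae_notMem.1 this

lemma measurable_symKernel (ρ : ℝ) : Measurable fun q : R4 × R4 => symKernel ρ q.1 q.2 := by
  have hφ := continuous_cutoff ρ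
  have h : Continuous fun q : R4 × R4 =>
      inner ℝ (cutoff ρ q.1 • q.1 - cutoff ρ q.2 • q.2) (q.1 - q.2) := by fun_prop
  exact h.measurable.div (by fun_prop)

/-- The Pohozaev identity for normal solutions with curvature `1 - |x|^p`. -/
theorem pohozaev {p : ℝ} (hp : 0 < p) {f : R4 → ℝ} (hf : Integrable f)
    (hm : Integrable fun y => negLog ‖y‖ * f y) (hr : HasLocallyBoundedRiesz f) {c : ℝ}
    (hfe : f =ᵐ[volume] fun x => curvK p x * exp (4 * logPot f c 0 x)) :
    4 * (∫ x, f x) - p * ∫ x : R4, ‖x‖ ^ p * exp (4 * logPot f c 0 x) =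
      1 / (4 * π ^ 2) * (∫ x, f x) ^ 2 := by
  have hw := integrable_norm_rpow_mul_exp hp hf hm hfe
  have l1 : Tendsto (fun ρ => ∫ x, (4 * cutoff ρ x + cutoffDeriv ρ x) * f x) atTop
      (𝓝 (∫ x, (4 * 1 + 0) * f x)) := by
    refine tendsto_integral_filter_of_dominated_convergence (fun x => 8 * |f x|)
      (Eventually.of_forall fun ρ => (((continuous_cutoff ρ).const_mul 4).add
        (continuous_cutoffDeriv ρ)).aestronglyMeasurable.mul hf.aestronglyMeasurable)
      (Eventually.of_forall fun ρ => ae_of_all _ fun x => ?_) (hf.abs.const_mul 8)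
      (ae_of_all _ fun x => (((tendsto_cutoff x).const_mul 4).add
        (tendsto_cutoffDeriv x)).mul_const _)
    rw [norm_mul]
    refine mul_le_mul_of_nonneg_right ((norm_add_le _ _).trans ?_) (norm_nonneg _)
    rw [norm_mul, norm_eq_abs, norm_eq_abs, norm_eq_abs, abs_of_pos (by norm_num : (0 : ℝ) < 4)]
    linarith [abs_cutoff_le_one ρ x, abs_cutoffDeriv_le ρ x]
  have l2 : Tendsto (fun ρ => ∫ x, cutoff ρ x * (‖x‖ ^ p * exp (4 * logPot f c 0 x))) atTop
      (𝓝 (∫ x : R4, 1 * (‖x‖ ^ p * exp (4 * logPot f c 0 x)))) := by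
    refine tendsto_integral_filter_of_dominated_convergence _
      (Eventually.of_forall fun ρ => (continuous_cutoff ρ).aestronglyMeasurable.mul
        hw.aestronglyMeasurable)
      (Eventually.of_forall fun ρ => ae_of_all _ fun x => ?_) hw
      (ae_of_all _ fun x => (tendsto_cutoff x).mul_const _)
    have h0 : 0 ≤ ‖x‖ ^ p * exp (4 * logPot f c 0 x) := by positivity
    rw [norm_mul, norm_of_nonneg h0]
    exact mul_le_of_le_one_left h0 (abs_cutoff_le_one ρ x)
  have hff : Integrable (fun q : R4 × R4 => f q.1 * f q.2) (volume.prod volume) := hf.mul_prod hf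
  -- Off the null diagonal `symKernel` tends to `|x - y|² / |x - y|² = 1`, and it is bounded by `5`
  -- uniformly in `ρ`; the limit is the square of the total mass.
  have l3 : Tendsto (fun ρ => ∫ q : R4 × R4, symKernel ρ q.1 q.2 * (f q.1 * f q.2)) atTop
      (𝓝 (∫ q : R4 × R4, 1 * (f q.1 * f q.2))) := by
    refine tendsto_integral_filter_of_dominated_convergence (fun q => 5 * |f q.1 * f q.2|)
      (Eventually.of_forall fun ρ => (measurable_symKernel ρ).aestronglyMeasurable.mul
        hff.aestronglyMeasurable) ?_ (hff.abs.const_mul 5) ?_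
    · filter_upwards [eventually_gt_atTop 0] with ρ hρ
      refine ae_of_all _ fun q => ?_
      rw [norm_mul]
      exact mul_le_mul_of_nonneg_right (abs_symKernel_le hρ _ _) (norm_nonneg _)
    · filter_upwards [ae_prod_ne] with q hq
      refine Tendsto.mul_const _ ?_
      have hz : ‖q.1 - q.2‖ ≠ 0 := norm_ne_zero_iff.2 (sub_ne_zero.2 hq)
      have h1 : Tendsto (fun ρ => cutoff ρ q.1 • q.1 - cutoff ρ q.2 • q.2) atTop
          (𝓝 ((1 : ℝ) • q.1 - (1 : ℝ) • q.2)) :=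
        ((tendsto_cutoff q.1).smul_const _).sub ((tendsto_cutoff q.2).smul_const _)
      have h2 := (h1.inner (tendsto_const_nhds (x := q.1 - q.2)) (𝕜 := ℝ)).div_const
        (‖q.1 - q.2‖ ^ 2)
      simp only [one_smul, real_inner_self_eq_norm_sq] at h2
      rwa [div_self (pow_ne_zero 2 hz)] at h2
  have hlim := (l1.sub (l2.const_mul p)).congr' (f₂ := fun ρ => 1 / (4 * π ^ 2) *
      ∫ q : R4 × R4, symKernel ρ q.1 q.2 * (f q.1 * f q.2)) (by
    filter_upwards [eventually_gt_atTop 0] with ρ hρ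
    exact pohozaev_cutoff hp hf hm hr hfe hρ)
  have := tendsto_nhds_unique hlim (l3.const_mul (1 / (4 * π ^ 2)))
  have e4 : ∫ q : R4 × R4, f q.1 * f q.2 = (∫ x, f x) ^ 2 := by
    rw [sq]
    exact integral_prod_mul f f
  simpa only [mul_one, add_zero, one_mul, integral_const_mul, e4] using this

/-- If the mass were at least `16π²`, the quadratic side of the Pohozaev identity would be at least
four times the mass, leaving no room for the positive term in `|x|^p`. -/
theorem integral_lt_of_eq_curvK_mul_exp {p : ℝ} (hp : 0 < p) {f : R4 → ℝ} (hf : Integrable f)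
    (hm : Integrable fun y => negLog ‖y‖ * f y) {c : ℝ}
    (hfe : f =ᵐ[volume] fun x => curvK p x * exp (4 * logPot f c 0 x)) :
    ∫ x, f x < 16 * π ^ 2 := by
  have hr := hasLocallyBoundedRiesz_of_sq hf (integrableOn_sq_of_eq_curvK_mul_exp hp hf hm hfe)
  have hw := integrable_norm_rpow_mul_exp hp hf hm hfe
  have hpos : 0 < ∫ x : R4, ‖x‖ ^ p * exp (4 * logPot f c 0 x) := by
    rw [integral_pos_iff_support_of_nonneg (fun x => by positivity) hw]
    refine lt_of_lt_of_le ?_ (measure_mono (s := Metric.ball (EuclideanSpace.single 0 1) 1) ?_)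
    · exact Metric.measure_ball_pos _ _ one_pos
    · intro x hx
      have hx0 : x ≠ 0 := by
        rintro rfl
        simp at hx
      have : 0 < ‖x‖ := norm_pos_iff.2 hx0
      exact ne_of_gt (by positivity)
  have hP := pohozaev hp hf hm hr hfe
  by_contra! hle
  have hpi : 0 < π ^ 2 := by positivity
  have h1 : 4 * (∫ x, f x) ≤ 1 / (4 * π ^ 2) * (∫ x, f x) ^ 2 := by
    rw [one_div, inv_mul_eq_div, le_div_iff₀ (by positivity)]
    nlinarith
  nlinarith

/-! ### The lower bound for the total curvature -/

/-- A ball of radius `R` at distance comparable to `R` from the origin. -/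
noncomputable def farBall (R : ℝ) : Set R4 := Metric.ball (EuclideanSpace.single 0 (2 * R)) R

lemma norm_mem_farBall {R : ℝ} (hR : 0 < R) {x : R4} (hx : x ∈ farBall R) :
    R ≤ ‖x‖ ∧ ‖x‖ ≤ 3 * R := by
  have h1 : ‖x - EuclideanSpace.single 0 (2 * R)‖ < R := by
    simpa [farBall, dist_eq_norm] using hx
  have h2 : ‖(EuclideanSpace.single 0 (2 * R) : R4)‖ = 2 * R := by
    simp [abs_of_pos hR]
  have h3 := norm_sub_norm_le (EuclideanSpace.single 0 (2 * R) : R4) x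
  have h4 := norm_sub_norm_le x (EuclideanSpace.single 0 (2 * R) : R4)
  rw [norm_sub_rev] at h3
  constructor <;> linarith

lemma measurableSet_farBall (R : ℝ) : MeasurableSet (farBall R) :=
  Metric.isOpen_ball.measurableSet

lemma volume_farBall_ne_top (R : ℝ) : volume (farBall R) ≠ ⊤ :=
  Metric.isBounded_ball.measure_lt_top.ne

lemma volume_real_farBall {R : ℝ} (hR : 0 < R) :
    volume.real (farBall R) = R ^ 4 * volume.real (Metric.ball (0 : R4) 1) := by
  rw [farBall, Measure.real, Measure.addHaar_ball_of_pos _ _ hR, ENNReal.toReal_mul,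
    ENNReal.toReal_ofReal (by positivity)]
  simp [Measure.real]

lemma volume_real_unitBall_pos : 0 < volume.real (Metric.ball (0 : R4) 1) :=
  ENNReal.toReal_pos (Metric.measure_ball_pos _ _ one_pos).ne'
    Metric.isBounded_ball.measure_lt_top.ne

lemma integrable_logKernel_prod_farBall {f : R4 → ℝ} (hf : Integrable f)
    (hm : Integrable fun y => negLog ‖y‖ * f y) {R : ℝ} (hR : 0 < R) :
    Integrable (fun q : R4 × R4 => logKernel 0 q.1 q.2 * f q.2)
      ((volume.restrict (farBall R)).prod volume) := by
  have : IsFiniteMeasure ((volume : Measure R4).restrict (farBall R)) :=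
    ⟨by simpa using (volume_farBall_ne_top R).lt_top⟩
  have h0 : Integrable (fun y => log (2 + 3 * R) * |f y| + |negLog ‖y‖ * f y|) :=
    (hf.abs.const_mul _).add hm.abs
  have h1 : Integrable (fun q : R4 × R4 => log (2 + 3 * R) * |f q.2| + |negLog ‖q.2‖ * f q.2|)
      ((volume.restrict (farBall R)).prod volume) := h0.comp_snd _
  have hprod : ((volume : Measure R4).restrict (farBall R)).prod (volume : Measure R4) =
      ((volume : Measure R4).prod volume).restrict (farBall R ×ˢ Set.univ) := by
    rw [← Measure.prod_restrict, Measure.restrict_univ]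
  have h2 : Integrable (fun q : R4 × R4 => truncKernel (q.1 - q.2) * |f q.2|)
      ((volume.restrict (farBall R)).prod volume) := by
    rw [hprod]
    exact (integrable_truncKernel_conv hf).restrict
  refine (h1.add h2).mono' ((measurable_logKernel 0).aestronglyMeasurable.mul
    hf.aestronglyMeasurable.comp_snd) ?_
  have hne : ∀ᵐ q : R4 × R4 ∂((volume.restrict (farBall R)).prod volume), q.1 ≠ q.2 := by
    rw [hprod]
    exact ae_restrict_of_ae ae_prod_ne
  have hy : ∀ᵐ q : R4 × R4 ∂((volume.restrict (farBall R)).prod volume), q.2 ≠ 0 :=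
    Measure.quasiMeasurePreserving_snd.ae (Measure.ae_ne volume 0)
  have hx : ∀ᵐ q : R4 × R4 ∂((volume.restrict (farBall R)).prod volume), q.1 ∈ farBall R :=
    Measure.quasiMeasurePreserving_fst.ae (ae_restrict_mem (measurableSet_farBall R))
  filter_upwards [hne, hy, hx] with q h3 h4 h5
  have hk := abs_logKernel_le (ε := 0) (by simp) h4 h3.symm
  have hlog : log (2 + ‖q.1‖) ≤ log (2 + 3 * R) :=
    log_le_log (by positivity) (by linarith [(norm_mem_farBall hR h5).2])
  rw [Pi.add_apply, norm_mul, norm_eq_abs, norm_eq_abs, abs_mul (negLog _),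
    abs_of_nonneg (negLog_nonneg ‖q.2‖), ← add_mul, ← add_mul]
  refine mul_le_mul_of_nonneg_right ?_ (abs_nonneg _)
  linarith [negLog_le_truncKernel (q.1 - q.2)]

/-- Fubini moves the average over the ball from the potential to the kernel. Joint integrability
comes from the convolution with `truncKernel`, so no Riesz bound is needed. -/
lemma integral_logPot_farBall {f : R4 → ℝ} (hf : Integrable f)
    (hm : Integrable fun y => negLog ‖y‖ * f y) (c : ℝ) {R : ℝ} (hR : 0 < R) :
    IntegrableOn (logPot f c 0) (farBall R) ∧
    ∫ x in farBall R, logPot f c 0 x =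
      1 / (8 * π ^ 2) * (∫ y, (∫ x in farBall R, logKernel 0 x y) * f y) +
        c * volume.real (farBall R) := by
  have hi := integrable_logKernel_prod_farBall hf hm hR
  have h1 : IntegrableOn (fun x => 1 / (8 * π ^ 2) * ∫ y, logKernel 0 x y * f y) (farBall R) :=
    hi.integral_prod_left.const_mul _
  have hc : IntegrableOn (fun _ : R4 => c) (farBall R) :=
    integrableOn_const (volume_farBall_ne_top R)
  refine ⟨h1.add hc, ?_⟩
  simp only [logPot]
  rw [integral_add h1 hc, integral_const_mul, integral_integral_swap hi, setIntegral_const,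
    smul_eq_mul, mul_comm (volume.real _)]
  simp only [integral_mul_const]

/-- The logarithmic kernel, averaged over `farBall R` and divided by `log R`. -/
noncomputable def meanLogKernel (R : ℝ) (y : R4) : ℝ :=
  (∫ x in farBall R, logKernel 0 x y) / (volume.real (farBall R) * log R)

lemma volume_real_farBall_pos {R : ℝ} (hR : 0 < R) : 0 < volume.real (farBall R) := by
  rw [volume_real_farBall hR]
  exact mul_pos (by positivity) volume_real_unitBall_pos

/-- A bound independent of `R`, for dominated convergence in `y`. The condition `4 ≤ R` ensures `log
R ≥ 1` and `2 + 3R ≤ R²`. -/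
lemma abs_meanLogKernel_le {R : ℝ} (hR : 4 ≤ R) {y : R4} (hy : y ≠ 0) :
    |meanLogKernel R y| ≤
      2 + negLog ‖y‖ + (∫ z, truncKernel z) / volume.real (Metric.ball (0 : R4) 1) := by
  have hR0 : 0 < R := by linarith
  have hv := volume_real_unitBall_pos
  have hV := volume_real_farBall_pos hR0
  have hlog1 : 1 ≤ log R := by
    rw [le_log_iff_exp_le hR0]
    linarith [exp_one_lt_d9]
  have hlog2 : log (2 + 3 * R) ≤ 2 * log R := by
    have : log (R ^ 2) = 2 * log R := by simp
    rw [← this]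
    exact log_le_log (by positivity) (by nlinarith)
  have hk : Integrable fun x => truncKernel (x - y) := integrable_truncKernel.comp_sub_right y
  have hT0 : 0 ≤ ∫ z, truncKernel z := integral_nonneg truncKernel_nonneg
  have hn0 := negLog_nonneg ‖y‖
  have hb1 : IntegrableOn (fun _ : R4 => log (2 + 3 * R) + negLog ‖y‖) (farBall R) :=
    integrableOn_const (volume_farBall_ne_top R)
  have h1 : |∫ x in farBall R, logKernel 0 x y| ≤
      ∫ x in farBall R, (log (2 + 3 * R) + negLog ‖y‖) + truncKernel (x - y) := by
    rw [← norm_eq_abs]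
    refine norm_integral_le_of_norm_le (hb1.add hk.integrableOn) ?_
    rw [ae_restrict_iff' (measurableSet_farBall R)]
    filter_upwards [Measure.ae_ne volume y] with x hxy hx
    have hk := abs_logKernel_le (ε := 0) (by simp) hy hxy.symm
    have hlog : log (2 + ‖x‖) ≤ log (2 + 3 * R) :=
      log_le_log (by positivity) (by linarith [(norm_mem_farBall hR0 hx).2])
    rw [norm_eq_abs]
    linarith [negLog_le_truncKernel (x - y)]
  have h2 : ∫ x in farBall R, truncKernel (x - y) ≤ ∫ z, truncKernel z := by
    rw [← integral_sub_right_eq_self truncKernel y]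
    exact setIntegral_le_integral hk (ae_of_all _ fun x => truncKernel_nonneg _)
  rw [integral_add hb1 hk.integrableOn, setIntegral_const, smul_eq_mul] at h1
  rw [meanLogKernel, abs_div, abs_of_pos (by positivity : 0 < volume.real (farBall R) * log R),
    div_le_iff₀ (by positivity)]
  have h3 : (∫ z, truncKernel z) ≤ (∫ z, truncKernel z) / volume.real (Metric.ball (0 : R4) 1) *
      (volume.real (farBall R) * log R) := by
    rw [volume_real_farBall hR0, div_mul_eq_mul_div, le_div_iff₀ hv]
    have hR4 : 1 ≤ R ^ 4 := one_le_pow₀ (by linarith)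
    have : 1 ≤ R ^ 4 * log R := by nlinarith
    calc _ = (∫ z, truncKernel z) * volume.real (Metric.ball (0 : R4) 1) * 1 := by ring
      _ ≤ (∫ z, truncKernel z) * volume.real (Metric.ball (0 : R4) 1) * (R ^ 4 * log R) := by gcongr
      _ = _ := by ring
  have h4 : log (2 + 3 * R) + negLog ‖y‖ ≤ (2 + negLog ‖y‖) * log R := by nlinarith
  have h5 := mul_le_mul_of_nonneg_left h4 hV.le
  calc _ ≤ _ := h1
    _ ≤ volume.real (farBall R) * ((2 + negLog ‖y‖) * log R) +
        (∫ z, truncKernel z) / volume.real (Metric.ball (0 : R4) 1) *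
      (volume.real (farBall R) * log R) := add_le_add h5 (h2.trans h3)
    _ = _ := by ring

/-- Once `R ≥ 2|y|`, the distance `|x - y|` is within a factor `4` of `R` on the ball, so the kernel
is `-log R` up to a bounded error. -/
lemma tendsto_meanLogKernel {y : R4} (hy : y ≠ 0) :
    Tendsto (fun R => meanLogKernel R y) atTop (𝓝 (-1)) := by
  have hy0 : 0 < ‖y‖ := norm_pos_iff.2 hy
  have hlim : Tendsto (fun R => (|log ‖y‖| + log 4) / log R) atTop (𝓝 0) :=
    tendsto_const_nhds.div_atTop tendsto_log_atTop
  rw [tendsto_iff_norm_sub_tendsto_zero]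
  refine squeeze_zero' (Eventually.of_forall fun _ => norm_nonneg _) ?_ hlim
  filter_upwards [eventually_ge_atTop (max 4 (2 * ‖y‖))] with R hR
  have hR4 : 4 ≤ R := (le_max_left _ _).trans hR
  have hRy : 2 * ‖y‖ ≤ R := (le_max_right _ _).trans hR
  have hR0 : 0 < R := by linarith
  have hV := volume_real_farBall_pos hR0
  have hlog : 0 < log R := log_pos (by linarith)
  have hpt : ∀ x ∈ farBall R, ‖logKernel 0 x y + log R‖ ≤ |log ‖y‖| + log 4 := by
    intro x hx
    obtain ⟨h1, h2⟩ := norm_mem_farBall hR0 hx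
    have h3 := norm_sub_le x y
    have h4 := norm_sub_norm_le x y
    have hz : 0 < ‖x - y‖ := by linarith
    have h5 : log ‖x - y‖ ≤ log 4 + log R := by
      rw [← log_mul (by norm_num) hR0.ne']
      exact log_le_log hz (by linarith)
    have h6 : log R ≤ log 4 + log ‖x - y‖ := by
      rw [← log_mul (by norm_num) hz.ne']
      exact log_le_log hR0 (by linarith)
    have e : logKernel 0 x y = log ‖y‖ - log ‖x - y‖ := by simp [logKernel]
    rw [e, norm_eq_abs, abs_le]
    constructor <;> linarith [le_abs_self (log ‖y‖), neg_abs_le (log ‖y‖)]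
  have hmk : AEStronglyMeasurable (fun x => logKernel 0 x y) (volume.restrict (farBall R)) :=
    ((measurable_logKernel 0).comp measurable_prodMk_right).aestronglyMeasurable
  have hcst : ∀ a : ℝ, IntegrableOn (fun _ : R4 => a) (farBall R) :=
    fun a => integrableOn_const (volume_farBall_ne_top R)
  have hi : IntegrableOn (fun x => logKernel 0 x y) (farBall R) := by
    have : IntegrableOn (fun x => logKernel 0 x y + log R) (farBall R) := by
      refine Integrable.mono' (hcst (|log ‖y‖| + log 4)) (hmk.add_const _) ?_
      rw [ae_restrict_iff' (measurableSet_farBall R)]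
      exact ae_of_all _ hpt
    refine (this.sub (hcst (log R))).congr (ae_of_all _ fun x => ?_)
    simp
  have hb : ‖∫ x in farBall R, (logKernel 0 x y + log R)‖ ≤
      (|log ‖y‖| + log 4) * volume.real (farBall R) :=
    norm_setIntegral_le_of_norm_le_const (volume_farBall_ne_top R).lt_top hpt
  rw [integral_add hi (hcst _), setIntegral_const, smul_eq_mul] at hb
  have e : meanLogKernel R y - -1 = ((∫ x in farBall R, logKernel 0 x y) +
      volume.real (farBall R) * log R) / (volume.real (farBall R) * log R) := by
    rw [meanLogKernel, sub_neg_eq_add, add_div, div_self (by positivity)]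
  rw [e, norm_div, norm_of_nonneg (by positivity : 0 ≤ volume.real (farBall R) * log R),
    div_le_div_iff₀ (by positivity) hlog]
  calc _ ≤ (|log ‖y‖| + log 4) * volume.real (farBall R) * log R := by gcongr
    _ = _ := by ring

lemma aestronglyMeasurable_meanLogKernel (R : ℝ) :
    AEStronglyMeasurable (meanLogKernel R) volume := by
  have h : AEStronglyMeasurable (fun q : R4 × R4 => logKernel 0 q.2 q.1)
      (volume.prod (volume.restrict (farBall R))) :=
    ((measurable_logKernel 0).comp measurable_swap).aestronglyMeasurable
  exact h.integral_prod_right'.mul_const _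

lemma tendsto_integral_meanLogKernel {f : R4 → ℝ} (hf : Integrable f)
    (hm : Integrable fun y => negLog ‖y‖ * f y) :
    Tendsto (fun R => ∫ y, meanLogKernel R y * f y) atTop (𝓝 (∫ y, -1 * f y)) := by
  set T := (∫ z, truncKernel z) / volume.real (Metric.ball (0 : R4) 1)
  refine tendsto_integral_filter_of_dominated_convergence
    (fun y => (2 + T) * |f y| + |negLog ‖y‖ * f y|)
    (Eventually.of_forall fun R => (aestronglyMeasurable_meanLogKernel R).mul
      hf.aestronglyMeasurable) ?_
    ((hf.abs.const_mul _).add hm.abs) ?_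
  · filter_upwards [eventually_ge_atTop 4] with R hR
    filter_upwards [Measure.ae_ne volume (0 : R4)] with y hy
    rw [norm_mul, norm_eq_abs, norm_eq_abs, abs_mul (negLog _),
      abs_of_nonneg (negLog_nonneg ‖y‖), ← add_mul]
    refine mul_le_mul_of_nonneg_right ?_ (abs_nonneg _)
    linarith [abs_meanLogKernel_le hR hy]
  · filter_upwards [Measure.ae_ne volume (0 : R4)] with y hy
    exact (tendsto_meanLogKernel hy).mul_const _

/-- Integrate `s + 1 ≤ exp s` over the ball with `s = 4u + (4 + p) log R`. The right side is at most
`2 R⁴ ∫ |f|`; dividing by the volume, of order `R⁴`, and by `log R` sends it to zero, while the left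
side tends to `4 + p - Λ / (2π²)`. -/
theorem le_integral_of_eq_curvK_mul_exp {p : ℝ} (hp : 0 < p) {f : R4 → ℝ} (hf : Integrable f)
    (hm : Integrable fun y => negLog ‖y‖ * f y) {c : ℝ}
    (hfe : f =ᵐ[volume] fun x => curvK p x * exp (4 * logPot f c 0 x)) :
    (4 + p) * (2 * π ^ 2) ≤ ∫ x, f x := by
  set v := volume.real (Metric.ball (0 : R4) 1) with hv
  have hv0 : 0 < v := volume_real_unitBall_pos
  have hineq : ∀ᶠ R : ℝ in atTop,
      4 * (1 / (8 * π ^ 2) * (∫ y, meanLogKernel R y * f y) + c / log R) + (4 + p) ≤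
        2 * (∫ y, |f y|) / v / log R := by
    filter_upwards [eventually_ge_atTop 4, (tendsto_rpow_atTop hp).eventually_ge_atTop 2]
      with R hR hRp
    have hR0 : 0 < R := by linarith
    have hV := volume_real_farBall_pos hR0
    have hlog : 0 < log R := log_pos (by linarith)
    obtain ⟨hi, he⟩ := integral_logPot_farBall hf hm c hR0
    have hci : IntegrableOn (fun _ : R4 => (4 + p) * log R) (farBall R) :=
      integrableOn_const (volume_farBall_ne_top R)
    have hmain : ∫ x in farBall R, (4 * logPot f c 0 x + (4 + p) * log R) ≤
        ∫ x in farBall R, 2 * R ^ 4 * |f x| := by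
      refine setIntegral_mono_on_ae ((hi.const_mul 4).add hci) (hf.abs.const_mul _).integrableOn
        (measurableSet_farBall R) ?_
      filter_upwards [hfe] with x hx hxB
      have hxR := (norm_mem_farBall hR0 hxB).1
      have hn : R ^ p ≤ ‖x‖ ^ p := rpow_le_rpow hR0.le hxR hp.le
      have hE0 := exp_pos (4 * logPot f c 0 x)
      -- `|x|^p ≥ R^p ≥ 2` gives `|x|^p ≤ 2 |K(x)|`.
      have h1 : R ^ p * exp (4 * logPot f c 0 x) ≤ 2 * |f x| := by
        rw [hx, curvK, abs_mul, abs_of_pos hE0, abs_of_nonpos (by linarith), ← mul_assoc]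
        exact mul_le_mul_of_nonneg_right (by linarith) hE0.le
      have h2 : exp (4 * logPot f c 0 x + (4 + p) * log R) =
          R ^ 4 * (R ^ p * exp (4 * logPot f c 0 x)) := by
        rw [exp_add, mul_comm (4 + p), ← rpow_def_of_pos hR0, rpow_add hR0]
        norm_cast
        ring
      have h3 := add_one_le_exp (4 * logPot f c 0 x + (4 + p) * log R)
      rw [h2] at h3
      have h4 := mul_le_mul_of_nonneg_left h1 (by positivity : 0 ≤ R ^ 4)
      linarith
    have hright : ∫ x in farBall R, 2 * R ^ 4 * |f x| ≤ 2 * R ^ 4 * ∫ y, |f y| := by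
      rw [← integral_const_mul]
      exact setIntegral_le_integral (hf.abs.const_mul _) (ae_of_all _ fun x => by positivity)
    rw [integral_add (hi.const_mul 4) hci, integral_const_mul, setIntegral_const, smul_eq_mul,
      he] at hmain
    have hmean : ∫ y, (∫ x in farBall R, logKernel 0 x y) * f y =
        volume.real (farBall R) * log R * ∫ y, meanLogKernel R y * f y := by
      rw [← integral_const_mul]
      congr 1
      funext y
      rw [meanLogKernel]
      field_simp
    rw [hmean] at hmain
    have htot := hmain.trans hright
    rw [le_div_iff₀ hlog, le_div_iff₀ hv0]
    have hVe : volume.real (farBall R) = R ^ 4 * v := volume_real_farBall hR0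
    rw [hVe] at htot
    have hR4 : 0 < R ^ 4 := by positivity
    refine le_of_mul_le_mul_left ?_ hR4
    calc _ = _ := ?_
      _ ≤ _ := htot
      _ = _ := by ring
    field_simp
  have hl1 : Tendsto (fun R => 4 * (1 / (8 * π ^ 2) * (∫ y, meanLogKernel R y * f y) + c / log R) +
      (4 + p)) atTop (𝓝 (4 * (1 / (8 * π ^ 2) * (∫ y, -1 * f y) + 0) + (4 + p))) :=
    ((((tendsto_integral_meanLogKernel hf hm).const_mul _).add
      (tendsto_const_nhds.div_atTop tendsto_log_atTop)).const_mul 4).add_const _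
  have hl2 : Tendsto (fun R => 2 * (∫ y, |f y|) / v / log R) atTop (𝓝 0) :=
    tendsto_const_nhds.div_atTop tendsto_log_atTop
  have h := le_of_tendsto_of_tendsto hl1 hl2 hineq
  have hpi : 0 < π ^ 2 := by positivity
  rw [integral_const_mul] at h
  have e : 4 * (1 / (8 * π ^ 2) * (-1 * ∫ y, f y) + 0) = -((∫ y, f y) / (2 * π ^ 2)) := by
    field_simp
    ring
  rw [e] at h
  rw [← le_div_iff₀ (by positivity)]
  linarith

/-! ### Bounds for normal solutions and the conclusion -/

theorem IsNormalSolutionWithCurvature.bounds {p Λ : ℝ} (hp : 0 < p) {u : R4 → ℝ}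
    (hu : IsNormalSolutionWithCurvature p Λ u) : LambdaStar p ≤ Λ ∧ Λ < LambdaSph := by
  obtain ⟨⟨hf, c, hc⟩, hΛ⟩ := hu
  set f : R4 → ℝ := fun y => curvK p y * exp (4 * u y) with hfdef
  have hm := integrable_negLog_mul hf (hc.mono fun x hx => hx.1)
  -- `u` is replaced by its everywhere defined representative `logPot f c 0`; the two forms of the
  -- kernel can differ only at `y = 0` and `y = x`.
  have hfe : f =ᵐ[volume] fun x => curvK p x * exp (4 * logPot f c 0 x) := by
    filter_upwards [hc] with x hx
    have e : logPot f c 0 x = u x := by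
      rw [hx.2, logPot]
      congr 2
      refine integral_congr_ae ?_
      filter_upwards [ae_ne_pair x] with y hy
      rw [logKernel_zero hy.1 hy.2]
    rw [e]
  rw [hΛ]
  exact ⟨le_integral_of_eq_curvK_mul_exp hp hf hm hfe, integral_lt_of_eq_curvK_mul_exp hp hf hm hfe⟩

theorem theorem1p1 (p : ℝ) (hp : 0 < p) :
    (∀ Λ : ℝ, Λ ∈ Set.Iio (LambdaStar p) ∪ Set.Ici LambdaSph →
      ¬ ∃ u : R4 → ℝ, IsNormalSolutionWithCurvature p Λ u) ∧
    (4 ≤ p → ∀ Λ : ℝ, ¬ ∃ u : R4 → ℝ, IsNormalSolutionWithCurvature p Λ u) := by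
  refine ⟨?_, ?_⟩
  · rintro Λ hΛ ⟨u, hu⟩
    obtain ⟨h1, h2⟩ := hu.bounds hp
    rcases hΛ with h | h
    · exact absurd h1 (not_le.2 h)
    · exact absurd h2 (not_lt.2 h)
  · rintro hp4 Λ ⟨u, hu⟩
    obtain ⟨h1, h2⟩ := hu.bounds hp
    have hpi : 0 < π ^ 2 := by positivity
    rw [LambdaStar] at h1
    rw [LambdaSph] at h2
    -- For `p ≥ 4`, `(4 + p) 2π² ≥ 16π²`, so the admissible interval is empty.
    nlinarith
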